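/- \textbf{Proposition (the gap sensor is not sufficient for a reactive policy).} Let $X\subset\mathbb R^2$ be a simply connected polygon, i.e. a simply connected compact set that is the closure of its interior and whose boundary is a simple closed polygonal chain, with vertex set $\mathcal V$, and let $x_G\in X$ be a goal. A point robot moves in $X$ with unit speed according to $\dot q=(\sin\theta,\cos\theta)$, $\theta\in S^1$. An action $u\in U=S^1$ applied at $x$ moves the robot in the constant direction $u$ inside $X$ until the first point of $\mathcal V\cup\{x_G\}$ is reached (so until a vertex is reached, if $x_G\in\mathcal V$); an action that cannot be carried out inside $X$ leaves the state unchanged. The interaction stops at $x_G$. A state policy $\pi:X\setminus\{x_G\}\to U$ is \emph{distance-optimal} if from every initial state $x\in X$ repeated application of $\pi$ reaches $x_G$ after finitely many actions, along a path whose length is the least time in which any measurable control $\theta(\cdot)$ takes the robot from $x$ to $x_G$ inside $X$. A \emph{gap} at $x\in X$ is a direction in which the distance from $x$ to the boundary of $X$ (the length of the longest segment in $X$ starting at $x$ in that direction), as a function of the direction, is discontinuous. The identity of a gap consists of the vertex closest to $x$ in its direction and of the information whether the distance jumps on the side of increasing angles. Given any map $\ell$ from gap identities to a set $L$ of labels (constant,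 for anonymous gaps, or injective, for distinguishable gaps, or anything between), the \emph{gap sensor} $h:X\to Y$ maps $x$ to the cyclic sequence $[g_1,\dots,g_N]$ of the labels of the gaps at $x$ in the cyclic order of their directions; $Y$ is the set of cyclic sequences in $L$. A labeling $\kappa'$ \emph{refines} a labeling $\kappa$ of the same set, $\kappa'\succeq\kappa$, if every class (nonempty fibre) of $\kappa'$ is contained in a class of $\kappa$. Then, for every $X$, $x_G$ and $\ell$ as above: \begin{enumerate} \item there is exactly one distance-optimal state policy $\pi_X$; \item the gap sensor does not refine it: $h|_{X\setminus\{x_G\}}\not\succeq\pi_X$; \item consequently the gap sensor is not sufficient for a reactive policy: there is no $\pi_Y:Y\to U$ such that choosing the action $\pi_Y(h(x))$ at each state $x\neq x_G$ achieves distance-optimal navigation to $x_G$. \end{enumerate} -/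

import Mathlib

namespace GapNav

noncomputable section

/-- The Euclidean plane. -/
abbrev Plane : Type := EuclideanSpace ℝ (Fin 2)

/-! ### Refinement of labelings -/

/-- The equivalence classes of the labeling `κ`. -/
def classes {I A : Type*} (κ : I → A) : Set (Set I) :=
  Set.range fun i => {j | κ j = κ i}

/-- `κ'` is a refinement of `κ`: every class of `κ'` is contained in a class of `κ`. -/
def Refines {I A B : Type*} (κ' : I → A) (κ : I → B) : Prop :=
  ∀ C ∈ classes κ', ∃ D ∈ classes κ, C ⊆ D

/-! ### Polygons -/

/-- A polygon as a region of the plane: a compact set that is the closure of its interior and whose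
boundary is a simple closed polygonal chain (given by the cyclic list of its vertices). -/
structure PolygonalRegion where
  /-- the number of vertices -/
  n : ℕ
  /-- the boundary chain -/
  chain : Polygon Plane n
  three_le : 3 ≤ n
  vertices_injective : Function.Injective chain.vertices
  /-- two different edges meet at most in common end points -/
  edges_simple : ∀ i j : Fin n, i ≠ j →
    chain.edgeSet ℝ i ∩ chain.edgeSet ℝ j ⊆
      {chain i, chain (finRotate n i)} ∩ {chain j, chain (finRotate n j)}
  /-- the region itself -/
  carrier : Set Plane
  isCompact_carrier : IsCompact carrier
  closure_interior : closure (interior carrier) = carrier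
  frontier_carrier : frontier carrier = chain.boundary ℝ

/-- The set of vertices of the polygon. -/
def PolygonalRegion.vertexSet (P : PolygonalRegion) : Set Plane :=
  Set.range P.chain.vertices

/-! ### Motion of the point robot -/

/-- The velocity `(sin θ, cos θ)` produced by the control `θ ∈ S¹`. -/
def vel (θ : Real.Angle) : Plane := !₂[θ.sin, θ.cos]

/-- The position at time `t` of the robot that starts at `x` and uses the control `θ`:
the solution of `q' = (sin θ, cos θ)`, `q 0 = x`. -/
def position (x : Plane) (θ : ℝ → Real.Angle) (t : ℝ) : Plane :=
  x + ∫ s in (0 : ℝ)..t, vel (θ s)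

/-- The times `T` at which the robot can be brought from `x` to `xG` by a measurable control
while staying in the polygon. As the speed is one, these are the lengths of the paths. -/
def arrivalTimes (P : PolygonalRegion) (x xG : P.carrier) : Set ℝ :=
  {T | 0 ≤ T ∧ ∃ θ : ℝ → Real.Angle, Measurable (fun t => vel (θ t)) ∧
    (∀ t ∈ Set.Icc 0 T, position x θ t ∈ P.carrier) ∧ position x θ T = xG}

/-- The points at which an action ends: the vertices of the polygon and the goal
(for a goal at a vertex these are just the vertices). -/
def stopSet (P : PolygonalRegion) (xG : P.carrier) : Set Plane :=
  insert (xG : Plane) P.vertexSet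

/-- The action `u`, applied at `x`, ends at `y`: moving from `x` in the constant direction `u`
inside the polygon, `y` is the first point of the stop set that is reached. -/
def Moves (P : PolygonalRegion) (xG x : P.carrier) (u : Real.Angle) (y : P.carrier) : Prop :=
  ∃ t : ℝ, 0 < t ∧ (y : Plane) = (x : Plane) + t • vel u ∧
    segment ℝ (x : Plane) y ⊆ P.carrier ∧ (y : Plane) ∈ stopSet P xG ∧
    ∀ s ∈ Set.Ioo 0 t, (x : Plane) + s • vel u ∉ stopSet P xG

open Classical in
/-- The state transition function `f : X × U → X`. An action that cannot be carried out inside the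
polygon leaves the state unchanged. -/
def transition (P : PolygonalRegion) (xG x : P.carrier) (u : Real.Angle) : P.carrier :=
  if h : ∃ y : P.carrier, Moves P xG x u y then h.choose else x

/-! ### Policies -/

/-- The states at which an action has to be chosen; the interaction stops at the goal. -/
abbrev ActiveState (P : PolygonalRegion) (xG : P.carrier) : Type := {x : P.carrier // x ≠ xG}

/-- A state policy assigns an action to each state other than the goal. -/
abbrev StatePolicy (P : PolygonalRegion) (xG : P.carrier) : Type :=
  ActiveState P xG → Real.Angle

open Classical in
/-- The state trajectory from `x` under a state policy. -/
def run (P : PolygonalRegion) (xG : P.carrier) (π : StatePolicy P xG) (x : P.carrier) :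
    ℕ → P.carrier
  | 0 => x
  | k + 1 =>
    if h : run P xG π x k = xG then xG
    else transition P xG (run P xG π x k) (π ⟨run P xG π x k, h⟩)

/-- The length of the first `N` stages of the trajectory. -/
def runLength (P : PolygonalRegion) (xG : P.carrier) (π : StatePolicy P xG) (x : P.carrier)
    (N : ℕ) : ℝ :=
  ∑ k ∈ Finset.range N, dist (run P xG π x k) (run P xG π x (k + 1))

/-- The policy achieves distance-optimal navigation to `xG`: from every initial state the goal is
reached after finitely many stages, along a path of minimal length. -/
def IsDistanceOptimal (P : PolygonalRegion) (xG : P.carrier) (π : StatePolicy P xG) : Prop :=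
  ∀ x : P.carrier, ∃ N : ℕ, run P xG π x N = xG ∧
    IsLeast (arrivalTimes P x xG) (runLength P xG π x N)

/-- The sensor `h` is sufficient for a reactive policy: some policy that chooses the action as a
function of the current observation only achieves distance-optimal navigation. -/
def SufficientForReactive (P : PolygonalRegion) (xG : P.carrier) {Y : Type*}
    (h : P.carrier → Y) : Prop :=
  ∃ πY : Y → Real.Angle, IsDistanceOptimal P xG fun x => πY (h x)

/-! ### The gap sensor -/

/-- The distance from `x` to the boundary in the direction `φ`: how far one sees from `x`. -/
def sightLength (P : PolygonalRegion) (x : P.carrier) (φ : ℝ) : ℝ :=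
  sSup {t : ℝ | 0 ≤ t ∧ segment ℝ (x : Plane) ((x : Plane) + t • vel φ) ⊆ P.carrier}

/-- The directions of the gaps at `x`: the discontinuities of the distance to the boundary. -/
def gapDirections (P : PolygonalRegion) (x : P.carrier) : Set ℝ :=
  {φ | φ ∈ Set.Ico 0 (2 * Real.pi) ∧ ¬ ContinuousAt (sightLength P x) φ}

/-- Gaps are told apart by the vertex that causes them (given as the set whose only element is the
index of that vertex) and by the side on which the distance jumps. -/
abbrev GapId (P : PolygonalRegion) : Type := Set (Fin P.n) × Prop

/-- The identity of the gap in direction `φ`: the vertex closest to `x` on the line of sight, and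
whether the distance jumps on the side of increasing angles. -/
def gapId (P : PolygonalRegion) (x : P.carrier) (φ : ℝ) : GapId P :=
  ({i | ∃ t : ℝ, 0 < t ∧ P.chain i = (x : Plane) + t • vel φ ∧
      ∀ s ∈ Set.Ioo 0 t, (x : Plane) + s • vel φ ∉ P.vertexSet},
    ¬ ContinuousWithinAt (sightLength P x) (Set.Ioi φ) φ)

open Classical in
/-- The gap sensor with labels in `L`: it reports the cyclic sequence of the labels of the gaps,
in the order of their directions. The sensor reports neither distances nor angles: the label of a
gap depends on its identity only. (A constant `label` gives anonymous gaps, an injective one gaps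
that are told apart. There are always finitely many gaps, as each lies in the direction of a
vertex.) -/
def gapSensor (P : PolygonalRegion) {L : Type*} (label : GapId P → L) (x : P.carrier) : Cycle L :=
  if h : (gapDirections P x).Finite then
    ((h.toFinset.sort (· ≤ ·)).map fun φ => label (gapId P x φ) : List L)
  else Cycle.nil

end

end GapNav

/-! Write d for `polyDist`, the infimum of the lengths of polylines to the goal inside the region.
Near each of its points the region is star-shaped, and away from the vertices it is even convex.
Star-shapedness makes d finite and continuous, and shows that no control can beat it. Minimizing d
over a small circle around x gives a direction in which d decreases at unit speed. Such a descent
can only stop at a vertex or at the goal, since elsewhere local convexity would allow a corner to be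
cut (`exists_descends_stopSet`). Only finitely many stops exist and d drops at each, so greedy moves
reach the goal along a path of length d, and the optimal policies are exactly the greedy ones.

Uniqueness uses simple connectedness. Two shortest paths that leave x in different directions and
meet again bound a closed curve. Unless both lie on one line, the curve has a point farthest from a
suitable distant centre. A short chord behind this exposed point is enclosed by the curve, hence
lies in the region (`mem_of_enclosed`, by lifting a complex logarithm), and it shortens one of the
paths. On a single line the two paths must meet in the middle.

The negative part is a cardinality argument. The sensor has only countably many values, whatever the
labels. On a ball of points visible from the goal the optimal action points straight at the goal, so
it takes uncountably many values there, and it cannot factor through the sensor. -/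

open GapNav

/-! ### Local geometry of a polygonal region. -/

/-- The determinant of two plane vectors. -/
def planeDet (v w : Plane) : ℝ := v 0 * w 1 - v 1 * w 0

lemma continuous_planeDet_sub (v x : Plane) : Continuous fun y : Plane => planeDet v (y - x) := by
  unfold planeDet
  fun_prop

lemma planeDet_add_smul (v x w y : Plane) (s : ℝ) :
    planeDet v (y + s • w - x) = planeDet v (y - x) + s * planeDet v w := by
  simp [planeDet]; ring

lemma planeDet_smul_sub (v x q : Plane) (s : ℝ) :
    planeDet v (x + s • (q - x) - x) = s * planeDet v (q - x) := by
  simp [planeDet]; ring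

/-- A nonconstant affine function has no local maximum: move y along v rotated by a right angle. -/
lemma exists_planeDet_lt {v : Plane} (hv : v ≠ 0) (x y : Plane) {U : Set Plane} (hU : IsOpen U)
    (hy : y ∈ U) : ∃ y' ∈ U, planeDet v (y - x) < planeDet v (y' - x) := by
  have hpos : 0 < planeDet v !₂[-v 1, v 0] := by
    have h : v 0 ≠ 0 ∨ v 1 ≠ 0 := by
      by_contra! h
      exact hv (by ext i; fin_cases i <;> simp [h.1, h.2])
    simp only [planeDet, Matrix.cons_val_zero, Matrix.cons_val_one]
    rcases h with h | h
    · nlinarith [mul_self_pos.2 h, mul_self_nonneg (v 1)]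
    · nlinarith [mul_self_pos.2 h, mul_self_nonneg (v 0)]
  set n : Plane := !₂[-v 1, v 0]
  have hc : ContinuousAt (fun s : ℝ => y + s • n) 0 := by fun_prop
  have hev : ∀ᶠ s in nhds (0 : ℝ), y + s • n ∈ U :=
    hc.eventually_mem (hU.mem_nhds (by simpa using hy))
  obtain ⟨s, hs, hs0⟩ := ((hev.filter_mono nhdsWithin_le_nhds).and
    (self_mem_nhdsWithin (s := Set.Ioi (0 : ℝ)))).exists
  refine ⟨_, hs, ?_⟩
  rw [planeDet_add_smul]
  have := mul_pos hs0 hpos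
  linarith

lemma isOpen_planeDet_ne (v x : Plane) : IsOpen {y : Plane | planeDet v (y - x) ≠ 0} :=
  isOpen_ne.preimage (continuous_planeDet_sub v x)

lemma dense_planeDet_ne {v : Plane} (hv : v ≠ 0) (x : Plane) :
    Dense {y : Plane | planeDet v (y - x) ≠ 0} := by
  rw [dense_iff_inter_open]
  rintro U hU ⟨y, hy⟩
  obtain ⟨y', hy', h⟩ := exists_planeDet_lt hv x y hU hy
  by_cases h0 : planeDet v (y - x) = 0
  · exact ⟨y', hy', by simpa using (h0 ▸ h).ne'⟩
  · exact ⟨y, hy, h0⟩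

/-- Off the frontier, the plane splits into two disjoint open sets, the interior and the complement.
-/
lemma IsPreconnected.subset_interior_of_disjoint_frontier {α : Type*} [TopologicalSpace α]
    {s X : Set α} (hs : IsPreconnected s) (hX : IsClosed X) (hd : Disjoint s (frontier X))
    (hne : (s ∩ interior X).Nonempty) : s ⊆ interior X := by
  refine hs.subset_left_of_subset_union isOpen_interior hX.isOpen_compl ?_ ?_ hne
  · exact Set.disjoint_compl_right_iff_subset.2 interior_subset
  · intro y hy
    by_cases hyX : y ∈ X
    · left
      by_contra hyi
      exact hd.le_bot ⟨hy, hX.frontier_eq ▸ ⟨hyX, hyi⟩⟩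
    · exact Or.inr hyX

lemma isClosed_setOf_segment_subset {X : Set Plane} (hX : IsClosed X) (x : Plane) :
    IsClosed {q : Plane | segment ℝ x q ⊆ X} := by
  have : {q : Plane | segment ℝ x q ⊆ X} =
      ⋂ t ∈ Set.Icc (0 : ℝ) 1, (fun q : Plane => x + t • (q - x)) ⁻¹' X := by
    ext q
    simp only [segment_eq_image', Set.image_subset_iff, Set.mem_iInter]
    rfl
  rw [this]
  exact isClosed_biInter fun t _ => hX.preimage (by fun_prop)

namespace GapNav.PolygonalRegion

variable (P : PolygonalRegion)

/-- The direction vector of an edge. -/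
def edgeDir (i : Fin P.n) : Plane := P.chain (finRotate P.n i) - P.chain i

lemma edgeDir_ne_zero (i : Fin P.n) : P.edgeDir i ≠ 0 := by
  intro h
  have h1 := P.vertices_injective (sub_eq_zero.1 h)
  have key : ∀ n, 3 ≤ n → ∀ i : Fin n, finRotate n i ≠ i := by
    intro n hn i
    obtain ⟨m, rfl⟩ : ∃ m, n = m + 2 := ⟨n - 2, by omega⟩
    simp
  exact key _ P.three_le i h1

lemma isClosed_edgeSet (i : Fin P.n) : IsClosed (P.chain.edgeSet ℝ i) := by
  rw [Polygon.edgeSet_eq_image_edgePath]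
  exact (isCompact_Icc.image (P.chain.edgePath ℝ i).continuous_of_finiteDimensional).isClosed

lemma planeDet_edgeDir {i : Fin P.n} {x y : Plane} (hx : x ∈ P.chain.edgeSet ℝ i)
    (hy : y ∈ P.chain.edgeSet ℝ i) : planeDet (P.edgeDir i) (y - x) = 0 := by
  rw [Polygon.edgeSet_eq_image_edgePath] at hx hy
  obtain ⟨s, -, rfl⟩ := hx
  obtain ⟨t, -, rfl⟩ := hy
  simp [planeDet, edgeDir, Polygon.edgePath, AffineMap.lineMap_apply]
  ring

lemma isClosed_carrier : IsClosed P.carrier := P.isCompact_carrier.isClosed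

/-- Finitely many closed edges: those that miss x stay at a positive distance from it. -/
lemma eventually_edge (x : Plane) :
    ∀ᶠ y in nhds x, ∀ i, y ∈ P.chain.edgeSet ℝ i → x ∈ P.chain.edgeSet ℝ i := by
  rw [Filter.eventually_all]
  intro i
  by_cases hx : x ∈ P.chain.edgeSet ℝ i
  · exact Filter.Eventually.of_forall fun _ _ => hx
  · filter_upwards [(P.isClosed_edgeSet i).isOpen_compl.mem_nhds hx] with y hy h
    exact absurd h hy

lemma mem_frontier {y : Plane} : y ∈ frontier P.carrier ↔ ∃ i, y ∈ P.chain.edgeSet ℝ i := by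
  rw [P.frontier_carrier, Polygon.boundary, Set.mem_iUnion]

/-- The points that lie off all the lines through `x` in the direction of an edge. -/
def offLines (x : Plane) : Set Plane := ⋂ i, {y | planeDet (P.edgeDir i) (y - x) ≠ 0}

lemma isOpen_offLines (x : Plane) : IsOpen (P.offLines x) :=
  isOpen_iInter_of_finite fun _ => isOpen_planeDet_ne _ x

lemma dense_offLines (x : Plane) : Dense (P.offLines x) :=
  dense_iInter_of_isOpen (fun _ => isOpen_planeDet_ne _ x)
    fun i => dense_planeDet_ne (P.edgeDir_ne_zero i) x

lemma carrier_subset_closure (x : Plane) :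
    P.carrier ⊆ closure (interior P.carrier ∩ P.offLines x) := by
  conv_lhs => rw [← P.closure_interior]
  exact closure_minimal ((P.dense_offLines x).open_subset_closure_inter isOpen_interior)
    isClosed_closure

/-- Near x the frontier lies on lines through x. A half-open segment from x to a generic interior
point avoids these lines, so it never leaves the interior. -/
lemma exists_ball_offLines (x : Plane) : ∃ ε > 0, ∀ q ∈ Metric.ball x ε ∩
    (interior P.carrier ∩ P.offLines x), segment ℝ x q ⊆ P.carrier := by
  obtain ⟨ε, hε, h⟩ := Metric.eventually_nhds_iff.1 (P.eventually_edge x)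
  refine ⟨ε, hε, ?_⟩
  rintro q ⟨hqε, hqi, hqN⟩
  have hsub : (fun t : ℝ => x + t • (q - x)) '' Set.Ioc 0 1 ⊆ interior P.carrier := by
    refine IsPreconnected.subset_interior_of_disjoint_frontier
      (isPreconnected_Ioc.image _ (by fun_prop)) P.isClosed_carrier ?_
      ⟨q, ⟨1, by simp, by simp⟩, hqi⟩
    rw [Set.disjoint_left]
    rintro _ ⟨t, ht, rfl⟩ hf
    obtain ⟨i, hi⟩ := P.mem_frontier.1 hf
    have hd : dist (x + t • (q - x)) x < ε := by
      rw [dist_eq_norm, add_sub_cancel_left, norm_smul, Real.norm_of_nonneg ht.1.le, ← dist_eq_norm]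
      exact (mul_le_of_le_one_left dist_nonneg ht.2).trans_lt hqε
    have h0 := P.planeDet_edgeDir (h hd i hi) hi
    rw [planeDet_smul_sub] at h0
    exact (mul_ne_zero ht.1.ne' (Set.mem_iInter.1 hqN i)) h0
  -- The point x was arbitrary in the plane; it belongs to the region as a limit of interior points.
  have hcl : x ∈ P.carrier := by
    refine P.isClosed_carrier.mem_of_tendsto (b := nhdsWithin (0 : ℝ) (Set.Ioi 0))
      (f := fun t : ℝ => x + t • (q - x)) ?_ ?_
    · have : ContinuousAt (fun t : ℝ => x + t • (q - x)) 0 := by fun_prop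
      simpa using this.tendsto.mono_left nhdsWithin_le_nhds
    · filter_upwards [Ioc_mem_nhdsGT (zero_lt_one' ℝ)] with t ht
      exact interior_subset (hsub ⟨t, ht, rfl⟩)
  rw [segment_eq_image']
  rintro _ ⟨t, ht, rfl⟩
  rcases ht.1.eq_or_lt with rfl | h0
  · simpa using hcl
  · exact interior_subset (hsub ⟨t, ⟨h0, ht.2⟩, rfl⟩)

/-- The region is locally star-shaped. -/
lemma exists_star (x : Plane) :
    ∃ ε > 0, ∀ q ∈ P.carrier, dist q x < ε → segment ℝ x q ⊆ P.carrier := by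
  obtain ⟨ε, hε, h⟩ := P.exists_ball_offLines x
  refine ⟨ε, hε, fun q hq hd => ?_⟩
  -- Generic points are dense in the region, and being visible from x is a closed condition.
  have h1 : q ∈ closure (Metric.ball x ε ∩ (interior P.carrier ∩ P.offLines x)) :=
    Metric.isOpen_ball.inter_closure ⟨hd, P.carrier_subset_closure x hq⟩
  exact closure_minimal (fun q hq => h q hq) (isClosed_setOf_segment_subset P.isClosed_carrier x) h1

/-- From each point of the region an open set is visible. -/
lemma exists_visible_ball {x : Plane} (hx : x ∈ P.carrier) : ∃ q₀ : Plane, ∃ δ > 0, q₀ ≠ x ∧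
    ∀ q ∈ Metric.ball q₀ δ, segment ℝ x q ⊆ P.carrier := by
  obtain ⟨ε, hε, h⟩ := P.exists_ball_offLines x
  obtain ⟨q₀, hq₀⟩ : (Metric.ball x ε ∩ (interior P.carrier ∩ P.offLines x)).Nonempty :=
    mem_closure_iff.1 (P.carrier_subset_closure x hx) _ Metric.isOpen_ball
      (Metric.mem_ball_self hε)
  obtain ⟨δ, hδ, hb⟩ := Metric.isOpen_iff.1 (Metric.isOpen_ball.inter
    (isOpen_interior.inter (P.isOpen_offLines x))) q₀ hq₀
  refine ⟨q₀, δ, hδ, ?_, fun q hq => h q (hb hq)⟩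
  rintro rfl
  have := Set.mem_iInter.1 hq₀.2.2 ⟨0, by have := P.three_le; omega⟩
  simp [planeDet] at this

/-- The region is locally convex away from the vertices. -/
lemma exists_convex_ball {x : Plane} (hx : x ∈ P.carrier) (hv : x ∉ P.vertexSet) :
    ∃ ε > 0, Convex ℝ (P.carrier ∩ Metric.ball x ε) := by
  by_cases hxi : x ∈ interior P.carrier
  · obtain ⟨ε, hε, h⟩ := Metric.isOpen_iff.1 isOpen_interior x hxi
    refine ⟨ε, hε, ?_⟩
    rw [Set.inter_eq_right.2 (h.trans interior_subset)]
    exact convex_ball x ε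
  have hxf : x ∈ frontier P.carrier := by
    rw [P.isClosed_carrier.frontier_eq]
    exact ⟨hx, hxi⟩
  obtain ⟨i, hi⟩ := P.mem_frontier.1 hxf
  -- Different edges share only vertices, so near x the frontier lies on a single line.
  have huniq : ∀ j, x ∈ P.chain.edgeSet ℝ j → j = i := by
    intro j hj
    by_contra hne
    have h := (P.edges_simple j i hne ⟨hj, hi⟩).1
    rcases h with h | h
    · exact hv ⟨_, h.symm⟩
    · exact hv ⟨_, (Set.mem_singleton_iff.1 h).symm⟩
  obtain ⟨ε, hε, h⟩ := Metric.eventually_nhds_iff.1 (P.eventually_edge x)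
  set e := P.edgeDir i
  have hfr : ∀ y ∈ Metric.ball x ε, y ∈ frontier P.carrier → planeDet e (y - x) = 0 := by
    intro y hy hyf
    obtain ⟨j, hj⟩ := P.mem_frontier.1 hyf
    obtain rfl := huniq j (h hy j hj)
    exact P.planeDet_edgeDir hi hj
  -- An open half-disc is connected and misses the frontier, so it lies entirely inside or entirely
  -- outside the region.
  have key : ∀ v : Plane, v ≠ 0 → (∀ y ∈ Metric.ball x ε, y ∈ frontier P.carrier →
      planeDet v (y - x) = 0) →
      (∀ y ∈ Metric.ball x ε, 0 ≤ planeDet v (y - x) → y ∈ P.carrier) ∨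
      (∀ y ∈ Metric.ball x ε, 0 < planeDet v (y - x) → y ∉ P.carrier) := by
    intro v hv0 hfv
    have hH : Convex ℝ (Metric.ball x ε ∩ {y | 0 < planeDet v (y - x)}) := by
      refine (convex_ball x ε).inter ?_
      intro a ha b hb s t hs ht hst
      have : planeDet v (s • a + t • b - x) = s * planeDet v (a - x) + t * planeDet v (b - x) := by
        obtain rfl : s = 1 - t := by linarith
        simp [planeDet]; ring
      simp only [Set.mem_ofPred_eq] at ha hb ⊢
      rw [this]
      rcases hs.eq_or_lt with rfl | hs
      · have : t = 1 := by linarith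
        subst this; simpa using hb
      · have := mul_pos hs ha
        have := mul_nonneg ht hb.le
        linarith
    have hdisj : Disjoint (Metric.ball x ε ∩ {y | 0 < planeDet v (y - x)})
        (frontier P.carrier) := by
      rw [Set.disjoint_left]
      rintro y ⟨hy, hy0⟩ hf
      exact hy0.ne' (hfv y hy hf)
    by_cases hne : (Metric.ball x ε ∩ {y | 0 < planeDet v (y - x)} ∩
        interior P.carrier).Nonempty
    · left
      have hsub := hH.isPreconnected.subset_interior_of_disjoint_frontier P.isClosed_carrier
        hdisj hne
      intro y hy hy0
      by_contra hyX
      -- A missing point on the diameter would have missing points of the open half-disc next to it.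
      obtain ⟨y', hy', hlt⟩ := exists_planeDet_lt hv0 x y
        (Metric.isOpen_ball.inter P.isClosed_carrier.isOpen_compl) ⟨hy, hyX⟩
      exact hy'.2 (interior_subset (hsub ⟨hy'.1, hy0.trans_lt hlt⟩))
    · right
      intro y hy hy0 hyX
      have hyi : y ∉ interior P.carrier := fun hyi => hne ⟨y, ⟨hy, hy0⟩, hyi⟩
      exact hy0.ne' (hfv y hy (P.isClosed_carrier.frontier_eq ▸ ⟨hyX, hyi⟩))
  have hneg : ∀ y, planeDet (-e) (y - x) = - planeDet e (y - x) := by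
    intro y; simp [planeDet]; ring
  have hlin : ∀ (a b : Plane) (s t : ℝ), s + t = 1 →
      planeDet e (s • a + t • b - x) = s * planeDet e (a - x) + t * planeDet e (b - x) := by
    intro a b s t hst
    obtain rfl : s = 1 - t := by linarith
    simp [planeDet]; ring
  refine ⟨ε, hε, ?_⟩
  have he : e ≠ 0 := P.edgeDir_ne_zero i
  rcases key e he hfr with h1 | h1 <;>
    rcases key (-e) (neg_ne_zero.2 he) (fun y hy hf => by rw [hneg, hfr y hy hf, neg_zero])
      with h2 | h2
  -- Impossible at a frontier point, but the claim holds in this case anyway.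
  · rw [Set.inter_eq_right.2]
    · exact convex_ball x ε
    · intro y hy
      rcases le_total 0 (planeDet e (y - x)) with h0 | h0
      · exact h1 y hy h0
      · exact h2 y hy (by rw [hneg]; linarith)
  · intro a ha b hb s t hs ht hst
    have hmem := convex_ball x ε ha.2 hb.2 hs ht hst
    refine ⟨h1 _ hmem ?_, hmem⟩
    have ha' : 0 ≤ planeDet e (a - x) := by
      by_contra! hlt
      exact h2 a ha.2 (by rw [hneg]; linarith) ha.1
    have hb' : 0 ≤ planeDet e (b - x) := by
      by_contra! hlt
      exact h2 b hb.2 (by rw [hneg]; linarith) hb.1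
    rw [hlin _ _ _ _ hst]
    positivity
  · intro a ha b hb s t hs ht hst
    have hmem := convex_ball x ε ha.2 hb.2 hs ht hst
    refine ⟨h2 _ hmem ?_, hmem⟩
    have ha' : 0 ≤ -planeDet e (a - x) := by
      by_contra! hlt
      exact h1 a ha.2 (by linarith) ha.1
    have hb' : 0 ≤ -planeDet e (b - x) := by
      by_contra! hlt
      exact h1 b hb.2 (by linarith) hb.1
    rw [hneg, hlin _ _ _ _ hst]
    nlinarith [mul_nonneg hs ha', mul_nonneg ht hb']
  -- With both half-discs outside, the region near x would lie on a line and have no interior there.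
  · exfalso
    obtain ⟨y, hy, hyi, hyN⟩ := mem_closure_iff.1 (P.carrier_subset_closure x hx) _
      Metric.isOpen_ball (Metric.mem_ball_self hε)
    have hy0 : planeDet e (y - x) ≠ 0 := Set.mem_iInter.1 hyN i
    rcases hy0.lt_or_gt with h0 | h0
    · exact h2 y hy (by rw [hneg]; linarith) (interior_subset hyi)
    · exact h1 y hy h0 (interior_subset hyi)

lemma finite_vertexSet : P.vertexSet.Finite := Set.finite_range _

end GapNav.PolygonalRegion

/-! ### Polyline distance and its comparison with arrival times. -/

/-- `PolyReach X z p L`: there is a polyline of length `L` from `p` to `z` inside `X`. -/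
inductive PolyReach (X : Set Plane) (z : Plane) : Plane → ℝ → Prop
  | refl : PolyReach X z z 0
  | step {p q : Plane} {L : ℝ} : segment ℝ p q ⊆ X → PolyReach X z q L →
      PolyReach X z p (dist p q + L)

/-- The infimum of the lengths of the polylines from `p` to `z` inside `X`. -/
noncomputable def polyDist (X : Set Plane) (z p : Plane) : ℝ := sInf {L | PolyReach X z p L}

lemma PolyReach.dist_le {X : Set Plane} {z p : Plane} {L : ℝ} (h : PolyReach X z p L) :
    dist p z ≤ L := by
  induction h with
  | refl => simp
  | step _ _ ih => exact (dist_triangle _ _ _).trans (by linarith)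

lemma bddBelow_polyReach (X : Set Plane) (z p : Plane) : BddBelow {L | PolyReach X z p L} :=
  ⟨0, fun _ h => dist_nonneg.trans h.dist_le⟩

lemma PolyReach.polyDist_le {X : Set Plane} {z p : Plane} {L : ℝ} (h : PolyReach X z p L) :
    polyDist X z p ≤ L := csInf_le (bddBelow_polyReach X z p) h

/-- This includes unreachable points, where the infimum of the empty set is 0 by convention. -/
lemma polyDist_nonneg (X : Set Plane) (z p : Plane) : 0 ≤ polyDist X z p :=
  Real.sInf_nonneg fun _ h => dist_nonneg.trans h.dist_le

lemma polyDist_self (X : Set Plane) (z : Plane) : polyDist X z z = 0 :=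
  le_antisymm PolyReach.refl.polyDist_le (polyDist_nonneg X z z)

namespace GapNav

lemma norm_vel (u : Real.Angle) : ‖vel u‖ = 1 := by
  have := u.cos_sq_add_sin_sq
  simp [vel, EuclideanSpace.norm_eq, Fin.sum_univ_two, add_comm (u.sin ^ 2), this]

lemma vel_injective : Function.Injective vel := by
  intro u v h
  have h0 := congrArg (fun w : Plane => w 0) h
  have h1 := congrArg (fun w : Plane => w 1) h
  induction u using Real.Angle.induction_on
  induction v using Real.Angle.induction_on
  exact Real.Angle.cos_sin_inj (by simpa [vel] using h1) (by simpa [vel] using h0)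

lemma exists_vel_eq {v : Plane} (hv : ‖v‖ = 1) : ∃ u, vel u = v := by
  -- The coordinates are swapped because `vel` is (sin, cos).
  have hn : ‖(⟨v 1, v 0⟩ : ℂ)‖ = 1 := by
    rw [Complex.norm_def, Complex.normSq_mk]
    rw [EuclideanSpace.norm_eq, Fin.sum_univ_two] at hv
    simp only [Real.norm_eq_abs, sq_abs] at hv
    rw [← hv]; congr 1; ring
  have hne : (⟨v 1, v 0⟩ : ℂ) ≠ 0 := norm_ne_zero_iff.1 (by rw [hn]; exact one_ne_zero)
  refine ⟨(Complex.arg ⟨v 1, v 0⟩ : ℝ), ?_⟩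
  ext i
  fin_cases i
  · simp [vel, Complex.sin_arg, hn]
  · simp [vel, Complex.cos_arg hne, hn]

lemma intervalIntegrable_vel {θ : ℝ → Real.Angle} (h : Measurable fun t => vel (θ t)) (a b : ℝ) :
    IntervalIntegrable (fun t => vel (θ t)) MeasureTheory.volume a b :=
  (intervalIntegrable_const (c := (1 : ℝ))).mono_fun' h.aestronglyMeasurable
    (Filter.Eventually.of_forall fun t => by simp [norm_vel])

lemma dist_position_le {x : Plane} {θ : ℝ → Real.Angle} (h : Measurable fun t => vel (θ t))
    (s t : ℝ) : dist (position x θ s) (position x θ t) ≤ |s - t| := by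
  rw [dist_eq_norm, position, position, add_sub_add_left_eq_sub,
    intervalIntegral.integral_interval_sub_left (intervalIntegrable_vel h _ _)
      (intervalIntegrable_vel h _ _)]
  simpa using intervalIntegral.norm_integral_le_of_norm_le_const (C := 1) (a := t) (b := s)
    (f := fun t => vel (θ t)) fun t _ => (norm_vel (θ t)).le

lemma zero_mem_arrivalTimes (P : PolygonalRegion) (x : P.carrier) : 0 ∈ arrivalTimes P x x := by
  refine ⟨le_rfl, fun _ => 0, measurable_const, ?_, by simp [position]⟩
  intro t ht
  obtain rfl : t = 0 := le_antisymm ht.2 ht.1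
  simp [position]

/-- Concatenation of controls: run along the segment for the time `dist x y`, then apply the given
control with that delay. -/
lemma add_mem_arrivalTimes (P : PolygonalRegion) {x y z : P.carrier} {T : ℝ}
    (hxy : segment ℝ (x : Plane) y ⊆ P.carrier) (hT : T ∈ arrivalTimes P y z) :
    dist (x : Plane) y + T ∈ arrivalTimes P x z := by
  rcases eq_or_ne x y with rfl | hne
  · simpa using hT
  obtain ⟨hT0, θ, hm, hin, hend⟩ := hT
  set τ := dist (x : Plane) y with hτ
  have hτ0 : 0 < τ := dist_pos.2 fun h => hne (Subtype.ext h)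
  obtain ⟨u, hu⟩ : ∃ u, vel u = τ⁻¹ • ((y : Plane) - x) := exists_vel_eq (by
    rw [norm_smul, norm_inv, Real.norm_of_nonneg hτ0.le, ← dist_eq_norm, dist_comm, ← hτ]
    exact inv_mul_cancel₀ hτ0.ne')
  have hyx : (x : Plane) + τ • vel u = y := by
    rw [hu, smul_inv_smul₀ hτ0.ne']; abel
  set ψ : ℝ → Real.Angle := fun t => if t ≤ τ then u else θ (t - τ) with hψ
  have hψm : Measurable fun t => vel (ψ t) := by
    have : (fun t => vel (ψ t)) = fun t => if t ≤ τ then vel u else vel (θ (t - τ)) := by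
      ext1 t; simp only [hψ]; split_ifs <;> rfl
    rw [this]
    exact Measurable.ite measurableSet_Iic measurable_const
      (hm.comp (measurable_id.sub_const τ))
  have h1 : ∀ t ∈ Set.Icc 0 τ, position x ψ t = x + t • vel u := by
    intro t ht
    rw [position, intervalIntegral.integral_congr (g := fun _ => vel u)]
    · simp
    · intro s hs
      rw [Set.uIcc_of_le ht.1] at hs
      simp [hψ, hs.2.trans ht.2]
  have h2 : ∀ t, 0 ≤ t → position x ψ (τ + t) = position y θ t := by
    intro t ht
    have hc := intervalIntegral.integral_add_adjacent_intervals
      (intervalIntegrable_vel hψm 0 τ) (intervalIntegrable_vel hψm τ (τ + t))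
    have h3 := h1 τ ⟨hτ0.le, le_rfl⟩
    rw [hyx, position] at h3
    rw [position, position, ← hc, ← add_assoc, h3]
    congr 1
    have h4 : ∫ s in τ..(τ + t), vel (ψ s) = ∫ s in τ..(τ + t), vel (θ (s - τ)) := by
      refine intervalIntegral.integral_congr_ae (Filter.Eventually.of_forall fun s hs => ?_)
      rw [Set.uIoc_of_le (by linarith)] at hs
      simp [hψ, not_le.2 hs.1]
    rw [h4, intervalIntegral.integral_comp_sub_right (fun s => vel (θ s))]
    simp
  refine ⟨by positivity, ψ, hψm, ?_, by rw [h2 T hT0, hend]⟩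
  intro t ht
  rcases le_total t τ with h | h
  · rw [h1 t ⟨ht.1, h⟩]
    refine hxy ?_
    rw [segment_eq_image']
    refine ⟨t / τ, ⟨div_nonneg ht.1 hτ0.le, (div_le_one hτ0).2 h⟩, ?_⟩
    simp only [hu, smul_smul, div_eq_mul_inv]
  · have := h2 (t - τ) (by linarith)
    rw [add_sub_cancel] at this
    rw [this]
    exact hin _ ⟨by linarith, by linarith [ht.2]⟩

lemma polyReach_mem_arrivalTimes (P : PolygonalRegion) (z : P.carrier) {p : Plane} {L : ℝ}
    (h : PolyReach P.carrier z p L) : ∀ hp : p ∈ P.carrier, L ∈ arrivalTimes P ⟨p, hp⟩ z := by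
  induction h with
  | refl => intro hp; exact zero_mem_arrivalTimes P z
  | @step p q L hs _ ih =>
    intro hp
    have hq : q ∈ P.carrier := hs (right_mem_segment ℝ p q)
    exact add_mem_arrivalTimes P (x := ⟨p, hp⟩) (y := ⟨q, hq⟩) hs (ih hq)

variable {P : PolygonalRegion} (z : P.carrier)

/-- Local star-shapedness makes reachability locally constant, and the region is connected. -/
lemma exists_polyReach (hc : IsPreconnected P.carrier) {p : Plane} (hp : p ∈ P.carrier) :
    ∃ L, PolyReach P.carrier z p L := by
  have h := hc.induction₂' (fun a b => (∃ L, PolyReach P.carrier z a L) →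
      ∃ L, PolyReach P.carrier z b L) ?_ ?_ z.2 hp
  · exact h ⟨0, PolyReach.refl⟩
  · intro x _
    obtain ⟨ε, hε, hst⟩ := P.exists_star x
    filter_upwards [self_mem_nhdsWithin, mem_nhdsWithin_of_mem_nhds (Metric.ball_mem_nhds x hε)]
      with y hy hd
    have hxy := hst y hy hd
    exact ⟨fun ⟨L, hL⟩ => ⟨_, PolyReach.step (segment_symm ℝ x y ▸ hxy) hL⟩,
      fun ⟨L, hL⟩ => ⟨_, PolyReach.step hxy hL⟩⟩
  · intro _ _ _ _ _ _ h1 h2 h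
    exact h2 (h1 h)

lemma polyDist_le_add (hc : IsPreconnected P.carrier) {p q : Plane}
    (h : segment ℝ p q ⊆ P.carrier) :
    polyDist P.carrier z p ≤ dist p q + polyDist P.carrier z q := by
  rw [← sub_le_iff_le_add']
  refine le_csInf (exists_polyReach z hc (h (right_mem_segment ℝ p q))) fun L hL => ?_
  have := (PolyReach.step h hL).polyDist_le
  linarith

lemma dist_le_polyDist (hc : IsPreconnected P.carrier) {p : Plane} (hp : p ∈ P.carrier) :
    dist p z ≤ polyDist P.carrier z p :=
  le_csInf (exists_polyReach z hc hp) fun _ h => h.dist_le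

lemma continuousOn_polyDist (hc : IsPreconnected P.carrier) :
    ContinuousOn (polyDist P.carrier z) P.carrier := by
  intro x _
  obtain ⟨ε, hε, hst⟩ := P.exists_star x
  rw [Metric.continuousWithinAt_iff]
  intro δ hδ
  refine ⟨min ε δ, lt_min hε hδ, fun y hy hd => ?_⟩
  have hxy := hst y hy (hd.trans_le (min_le_left _ _))
  have h1 := polyDist_le_add z hc hxy
  have h2 := polyDist_le_add z hc (segment_symm ℝ x y ▸ hxy)
  rw [dist_comm x y] at h1
  refine lt_of_le_of_lt ?_ (hd.trans_le (min_le_right _ _))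
  rw [Real.dist_eq, abs_sub_le_iff]
  constructor <;> linarith

/-- Along a trajectory c the inequality d(x) ≤ t + d(c t) persists: it is a closed condition, and it
extends a little to the right because nearby points of the path are joined to c t by chords no
longer than the elapsed time. -/
lemma polyDist_le_of_mem_arrivalTimes (hc : IsPreconnected P.carrier) {x : P.carrier} {T : ℝ}
    (hT : T ∈ arrivalTimes P x z) : polyDist P.carrier z x ≤ T := by
  obtain ⟨hT0, θ, hm, hin, hend⟩ := hT
  set c := position (x : Plane) θ with hcdef
  have hcc : Continuous c := (LipschitzWith.of_dist_le_mul (K := 1) fun s t => by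
    simpa [Real.dist_eq] using dist_position_le (x := x) hm s t).continuous
  set S : Set ℝ := {t | polyDist P.carrier z x ≤ t + polyDist P.carrier z (c t)}
  have hsub : Set.Icc 0 T ⊆ S := by
    refine IsClosed.Icc_subset_of_forall_mem_nhdsWithin ?_ ?_ ?_
    · have hcon : ContinuousOn (fun t => t + polyDist P.carrier z (c t)) (Set.Icc 0 T) :=
        continuousOn_id.add ((continuousOn_polyDist z hc).comp hcc.continuousOn hin)
      have := hcon.preimage_isClosed_of_isClosed isClosed_Icc
        (isClosed_Ici (a := polyDist P.carrier z x))
      rw [Set.inter_comm]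
      exact this
    · simp [S, hcdef, position]
    · rintro t ⟨htS, ht⟩
      obtain ⟨ε, hε, hst⟩ := P.exists_star (c t)
      have hb : c ⁻¹' Metric.ball (c t) ε ∈ nhds t :=
        hcc.continuousAt (Metric.ball_mem_nhds _ hε)
      filter_upwards [mem_nhdsWithin_of_mem_nhds hb, Ioc_mem_nhdsGT ht.2] with t' h1 h2
      have h3 := polyDist_le_add z hc (hst _ (hin t' ⟨ht.1.trans h2.1.le, h2.2⟩) h1)
      have h4 := dist_position_le (x := x) hm t t'
      rw [abs_of_nonpos (by linarith [h2.1])] at h4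
      change polyDist P.carrier z x ≤ _ at htS
      change polyDist P.carrier z x ≤ _
      change dist (c t) (c t') ≤ _ at h4
      linarith
  have := hsub ⟨hT0, le_rfl⟩
  change polyDist P.carrier z x ≤ T + polyDist P.carrier z (c T) at this
  rwa [hend, polyDist_self, add_zero] at this

end GapNav

/-! ### Existence of straight descents ending at stops. -/

lemma segment_ray {x u : Plane} {a b : ℝ} (hab : a ≤ b) :
    segment ℝ (x + a • u) (x + b • u) = (fun s : ℝ => x + s • u) '' Set.Icc a b := by
  rw [segment_eq_image']
  ext w
  constructor
  · rintro ⟨t, ht, rfl⟩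
    refine ⟨a + t * (b - a), ⟨by nlinarith [ht.1], by nlinarith [ht.2]⟩, ?_⟩
    simp only
    module
  · rintro ⟨s, hs, rfl⟩
    rcases hab.eq_or_lt with rfl | hlt
    · obtain rfl : s = a := le_antisymm hs.2 hs.1
      exact ⟨0, by simp, by simp⟩
    · have h0 : 0 < b - a := by linarith
      refine ⟨(s - a) / (b - a), ⟨div_nonneg (by linarith [hs.1]) h0.le,
        (div_le_one h0).2 (by linarith [hs.2])⟩, ?_⟩
      have : s = a + (s - a) / (b - a) * (b - a) := by field_simp; ring
      simp only
      conv_rhs => rw [this]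
      module

lemma dist_ray {x u : Plane} (hu : ‖u‖ = 1) (a b : ℝ) :
    dist (x + a • u) (x + b • u) = |a - b| := by
  rw [dist_eq_norm, add_sub_add_left_eq_sub, ← sub_smul, norm_smul, hu, mul_one, Real.norm_eq_abs]

namespace GapNav

variable {P : PolygonalRegion} (z : P.carrier)

/-- Moving from `x` with velocity `u` for the time `τ` stays in the region and is the beginning of
a shortest path to `z`. -/
def Descends (x u : Plane) (τ : ℝ) : Prop :=
  ∀ s ∈ Set.Icc 0 τ, x + s • u ∈ P.carrier ∧
    polyDist P.carrier z x = s + polyDist P.carrier z (x + s • u)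

variable {z}

lemma Descends.trans {x u : Plane} {τ r : ℝ} (h : Descends z x u τ) (hτ : 0 ≤ τ)
    (h' : Descends z (x + τ • u) u r) : Descends z x u (τ + r) := by
  intro s hs
  rcases le_total s τ with h1 | h1
  · exact h s ⟨hs.1, h1⟩
  · have h2 := h' (s - τ) ⟨by linarith, by linarith [hs.2]⟩
    have h3 := h τ ⟨hτ, le_rfl⟩
    have h4 : x + τ • u + (s - τ) • u = x + s • u := by module
    rw [h4] at h2
    exact ⟨h2.1, by linarith [h2.2, h3.2]⟩

variable (z)

/-- A polyline from the disc to a goal that is not inside the open disc must cross the circle; the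
part after the crossing is at least as long as d there. -/
lemma exists_crossing (hc : IsPreconnected P.carrier) {x : Plane} {r : ℝ} (hr : r ≤ dist (z : Plane) x)
    {p : Plane} {L : ℝ} (h : PolyReach P.carrier z p L) : dist p x ≤ r →
    ∃ w ∈ P.carrier, dist w x = r ∧ dist p w + polyDist P.carrier z w ≤ L := by
  induction h with
  | refl => exact fun h => ⟨z, z.2, le_antisymm h hr, by simp [polyDist_self]⟩
  | @step p q L hs hL ih =>
    intro hp
    rcases le_or_gt (dist q x) r with hq | hq
    · obtain ⟨w, hw, hwr, hwL⟩ := ih hq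
      exact ⟨w, hw, hwr, by linarith [dist_triangle p q w]⟩
    · obtain ⟨w, hw, hwr⟩ := (convex_segment (𝕜 := ℝ) p q).isPreconnected.intermediate_value
        (left_mem_segment ℝ p q) (right_mem_segment ℝ p q)
        (f := fun w => dist w x) (by fun_prop) ⟨hp, hq.le⟩
      refine ⟨w, hs hw, hwr, ?_⟩
      have h1 : segment ℝ w q ⊆ P.carrier :=
        ((convex_segment p q).segment_subset hw (right_mem_segment ℝ p q)).trans hs
      have h2 := polyDist_le_add z hc h1
      have h3 := dist_add_dist_of_mem_segment hw
      have h4 := hL.polyDist_le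
      linarith

lemma exists_descends (hc : IsPreconnected P.carrier) {x : Plane} (hx : x ∈ P.carrier)
    (hne : x ≠ z) : ∃ u : Plane, ‖u‖ = 1 ∧ ∃ r > 0, Descends z x u r := by
  obtain ⟨ε, hε, hst⟩ := P.exists_star x
  -- Small enough for star-shapedness to give the radius to w, and for the circle not to enclose the
  -- goal.
  set r := min (ε / 2) (dist (z : Plane) x) with hr
  have hr0 : 0 < r := lt_min (by linarith) (dist_pos.2 hne.symm)
  have hcross : ∀ L, PolyReach P.carrier z x L →
      ∃ w ∈ P.carrier, dist w x = r ∧ dist x w + polyDist P.carrier z w ≤ L := fun L hL =>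
    exists_crossing z hc (min_le_right _ _) hL (by rw [dist_self]; exact hr0.le)
  have hcomp : IsCompact (P.carrier ∩ Metric.sphere x r) :=
    P.isCompact_carrier.inter_right Metric.isClosed_sphere
  obtain ⟨L₀, hL₀⟩ := exists_polyReach z hc hx
  obtain ⟨w₀, hw₀, hw₀r, -⟩ := hcross L₀ hL₀
  obtain ⟨w, ⟨hw, hwr⟩, hmin⟩ := hcomp.exists_isMinOn ⟨w₀, hw₀, hw₀r⟩
    ((continuousOn_polyDist z hc).mono Set.inter_subset_left)
  rw [Metric.mem_sphere] at hwr
  have hge : r + polyDist P.carrier z w ≤ polyDist P.carrier z x := by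
    refine le_csInf ⟨L₀, hL₀⟩ fun L hL => ?_
    obtain ⟨w', hw', hw'r, hle⟩ := hcross L hL
    have := isMinOn_iff.1 hmin w' ⟨hw', hw'r⟩
    rw [dist_comm, hw'r] at hle
    linarith
  set u : Plane := r⁻¹ • (w - x) with hu
  have hu1 : ‖u‖ = 1 := by
    rw [hu, norm_smul, norm_inv, Real.norm_of_nonneg hr0.le, ← dist_eq_norm, hwr]
    exact inv_mul_cancel₀ hr0.ne'
  have hwu : x + r • u = w := by
    rw [hu, smul_inv_smul₀ hr0.ne']; abel
  have hseg : ∀ a b, 0 ≤ a → a ≤ b → b ≤ r → segment ℝ (x + a • u) (x + b • u) ⊆ P.carrier := by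
    intro a b ha hab hb
    refine subset_trans ?_ (hst w hw (hwr.trans_lt ((min_le_left _ _).trans_lt (by linarith))))
    have := segment_ray (x := x) (u := u) hr0.le
    rw [zero_smul, add_zero, hwu] at this
    rw [segment_ray hab, this]
    exact Set.image_mono (Set.Icc_subset_Icc ha hb)
  refine ⟨u, hu1, r, hr0, fun s hs => ?_⟩
  -- The triangle inequalities on the two parts of the radius add up to `hge`, so both are
  -- equalities.
  have h1 := polyDist_le_add z hc (hseg 0 s le_rfl hs.1 hs.2)
  have h2 := polyDist_le_add z hc (hseg s r hs.1 hs.2 le_rfl)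
  rw [dist_ray hu1, abs_of_nonpos (by linarith [hs.1])] at h1
  rw [dist_ray hu1, abs_of_nonpos (by linarith [hs.2]), hwu] at h2
  rw [zero_smul, add_zero] at h1
  exact ⟨hseg s r hs.1 hs.2 le_rfl (left_mem_segment ℝ _ _), by linarith⟩

lemma Descends.segment_subset {z : P.carrier} {x u : Plane} {τ a b : ℝ} (h : Descends z x u τ)
    (ha : 0 ≤ a) (hab : a ≤ b) (hb : b ≤ τ) :
    segment ℝ (x + a • u) (x + b • u) ⊆ P.carrier := by
  rw [segment_ray hab]
  rintro _ ⟨s, hs, rfl⟩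
  exact (h s ⟨ha.trans hs.1, hs.2.trans hb⟩).1

lemma exists_descends_stopSet (hc : IsPreconnected P.carrier) {x : Plane} (hx : x ∈ P.carrier)
    (hne : x ≠ z) : ∃ u : Plane, ‖u‖ = 1 ∧ ∃ τ > 0, Descends z x u τ ∧ x + τ • u ∈ stopSet P z := by
  obtain ⟨u, hu, r, hr, hd⟩ := exists_descends z hc hx hne
  -- Follow the descent as long as possible; its duration is bounded by d(x), and by continuity the
  -- supremum is attained.
  set T : Set ℝ := {t | 0 ≤ t ∧ Descends z x u t}
  have hTb : BddAbove T := by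
    refine ⟨polyDist P.carrier z x, fun t ht => ?_⟩
    have := (ht.2 t ⟨ht.1, le_rfl⟩).2
    linarith [polyDist_nonneg P.carrier z (x + t • u)]
  have hrT : r ∈ T := ⟨hr.le, hd⟩
  set τ := sSup T with hτ
  have hrτ : r ≤ τ := le_csSup hTb hrT
  have hτ0 : 0 < τ := hr.trans_le hrτ
  have hlt : ∀ s, 0 ≤ s → s < τ → x + s • u ∈ P.carrier ∧
      polyDist P.carrier z x = s + polyDist P.carrier z (x + s • u) := by
    intro s hs hsτ
    obtain ⟨t, ht, hst⟩ := exists_lt_of_lt_csSup ⟨r, hrT⟩ hsτ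
    exact ht.2 s ⟨hs, hst.le⟩
  have hev : ∀ᶠ s in nhdsWithin τ (Set.Iio τ), 0 ≤ s ∧ s < τ := by
    filter_upwards [Ico_mem_nhdsLT hτ0] with s hs using hs
  have htend : Filter.Tendsto (fun s : ℝ => x + s • u) (nhdsWithin τ (Set.Iio τ))
      (nhds (x + τ • u)) := by
    have : Continuous fun s : ℝ => x + s • u := by fun_prop
    exact (this.tendsto τ).mono_left nhdsWithin_le_nhds
  have hyX : x + τ • u ∈ P.carrier :=
    P.isClosed_carrier.mem_of_tendsto htend (hev.mono fun s hs => (hlt s hs.1 hs.2).1)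
  have hyg : polyDist P.carrier z x = τ + polyDist P.carrier z (x + τ • u) := by
    have h1 : Filter.Tendsto (fun s : ℝ => s + polyDist P.carrier z (x + s • u))
        (nhdsWithin τ (Set.Iio τ)) (nhds (τ + polyDist P.carrier z (x + τ • u))) := by
      refine (tendsto_nhdsWithin_of_tendsto_nhds Filter.tendsto_id).add
        ((continuousOn_polyDist z hc _ hyX).tendsto.comp ?_)
      exact tendsto_nhdsWithin_iff.2 ⟨htend, hev.mono fun s hs => (hlt s hs.1 hs.2).1⟩
    refine tendsto_nhds_unique_of_eventuallyEq tendsto_const_nhds h1 ?_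
    exact hev.mono fun s hs => (hlt s hs.1 hs.2).2
  have hdτ : Descends z x u τ := by
    intro s hs
    rcases hs.2.eq_or_lt with rfl | h
    · exact ⟨hyX, hyg⟩
    · exact hlt s hs.1 h
  refine ⟨u, hu, τ, hτ0, hdτ, ?_⟩
  by_contra hyS
  set y := x + τ • u with hy
  have hyz : y ≠ z := fun h => hyS (Or.inl h)
  have hyv : y ∉ P.vertexSet := fun h => hyS (Or.inr h)
  obtain ⟨w, hw, r', hr', hd'⟩ := exists_descends z hc hyX hyz
  obtain ⟨ε, hε, hconv⟩ := P.exists_convex_ball hyX hyv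
  -- With equal directions the descent could be prolonged beyond its supremum.
  have huw : u ≠ w := by
    rintro rfl
    have : τ + r' ≤ τ := le_csSup hTb ⟨by linarith, hdτ.trans hτ0.le hd'⟩
    linarith
  set s := min (min r' τ) (ε / 2) with hs
  have hs0 : 0 < s := lt_min (lt_min hr' hτ0) (by linarith)
  have hsr : s ≤ r' := (min_le_left _ _).trans (min_le_left _ _)
  have hsτ : s ≤ τ := (min_le_left _ _).trans (min_le_right _ _)
  have hsε : s < ε := (min_le_right _ _).trans_lt (by linarith)
  have ha := hdτ (τ - s) ⟨by linarith, by linarith⟩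
  have hb := hd' s ⟨hs0.le, hsr⟩
  have hay : x + (τ - s) • u = y - s • u := by rw [hy]; module
  rw [hay] at ha
  -- Local convexity admits the chord across the corner at y. It is shorter than 2s, although d
  -- drops by 2s between its ends.
  have hseg : segment ℝ (y - s • u) (y + s • w) ⊆ P.carrier := by
    refine (hconv.segment_subset ⟨ha.1, ?_⟩ ⟨hb.1, ?_⟩).trans Set.inter_subset_left
    · simpa [Metric.mem_ball, dist_eq_norm, norm_smul, hu, abs_of_pos hs0] using hsε
    · simpa [Metric.mem_ball, dist_eq_norm, norm_smul, hw, abs_of_pos hs0] using hsε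
  have h1 := polyDist_le_add z hc hseg
  have h2 : dist (y - s • u) (y + s • w) = s * ‖u + w‖ := by
    rw [dist_comm, dist_eq_norm, show y + s • w - (y - s • u) = s • (u + w) by module, norm_smul,
      Real.norm_of_nonneg hs0.le]
  have h3 : ‖u + w‖ < 2 := by
    have := norm_add_lt_of_not_sameRay (x := u) (y := w) (fun h =>
      huw (h.eq_of_norm_eq (hu.trans hw.symm)))
    rw [hu, hw] at this
    linarith
  rw [h2] at h1
  nlinarith [ha.2, hb.2]

lemma finite_stopSet : (stopSet P z).Finite := P.finite_vertexSet.insert _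

/-- The action `u` at `x` is the beginning of a shortest path to `z`. -/
def GreedyMove (x : P.carrier) (u : Real.Angle) (y : P.carrier) : Prop :=
  Moves P z x u y ∧
    polyDist P.carrier z x = dist (x : Plane) y + polyDist P.carrier z y

lemma exists_greedyMove (hc : IsPreconnected P.carrier) {x : P.carrier} (hne : x ≠ z) :
    ∃ u y, GreedyMove z x u y := by
  obtain ⟨v, hv, τ, hτ, hd, hyS⟩ :=
    exists_descends_stopSet z hc x.2 (fun h => hne (Subtype.ext h))
  obtain ⟨u, rfl⟩ := exists_vel_eq hv
  have hinj : Function.Injective fun t : ℝ => (x : Plane) + t • vel u := by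
    intro a b hab
    have := dist_ray (x := (x : Plane)) hv a b
    rw [show (x : Plane) + a • vel u = x + b • vel u from hab, dist_self] at this
    exact sub_eq_zero.1 (abs_eq_zero.1 this.symm)
  -- The descent may pass other stops before τ, while an action ends at the earliest one.
  set F : Set ℝ := {t | 0 < t ∧ (x : Plane) + t • vel u ∈ stopSet P z}
  have hF : F.Finite := ((finite_stopSet z).preimage hinj.injOn).subset fun t ht => ht.2
  obtain ⟨t, ht, hmin⟩ := Set.exists_min_image F id hF ⟨τ, hτ, hyS⟩
  have htτ : t ≤ τ := hmin τ ⟨hτ, hyS⟩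
  have h1 := hd t ⟨ht.1.le, htτ⟩
  refine ⟨u, ⟨_, h1.1⟩, ⟨t, ht.1, rfl, ?_, ht.2, fun s hs hss => ?_⟩, ?_⟩
  · simpa using hd.segment_subset le_rfl ht.1.le htτ
  · exact absurd (hmin s ⟨hs.1, hss⟩) (not_le.2 hs.2)
  · have := dist_ray (x := (x : Plane)) hv 0 t
    rw [zero_smul, add_zero, zero_sub, abs_neg, abs_of_pos ht.1] at this
    rw [this]
    exact h1.2

end GapNav

/-! ### Enclosed points of a simply connected region. -/

lemma eq_zero_of_inner_of_planeDet {n v : Plane} (hn : n ≠ 0) (hi : inner ℝ n v = 0)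
    (hd : planeDet n v = 0) : v = 0 := by
  simp only [PiLp.inner_apply, Fin.sum_univ_two, RCLike.inner_apply, conj_trivial] at hi
  simp only [planeDet] at hd
  have hpos : 0 < n 0 * n 0 + n 1 * n 1 := by
    by_contra! hle
    have e0 : n 0 = 0 := by nlinarith [mul_self_nonneg (n 0), mul_self_nonneg (n 1)]
    have e1 : n 1 = 0 := by nlinarith [mul_self_nonneg (n 0), mul_self_nonneg (n 1)]
    exact hn (by ext i; fin_cases i <;> simp [e0, e1])
  have e0 : (n 0 * n 0 + n 1 * n 1) * v 0 = 0 := by linear_combination n 0 * hi - n 1 * hd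
  have e1 : (n 0 * n 0 + n 1 * n 1) * v 1 = 0 := by linear_combination n 1 * hi + n 0 * hd
  ext i
  fin_cases i
  · exact (mul_eq_zero.1 e0).resolve_left hpos.ne'
  · exact (mul_eq_zero.1 e1).resolve_left hpos.ne'

/-- Needed for lifting maps through the exponential covering: small balls meet X in star-convex
sets. -/
lemma locallyPathConnectedSpace_of_star {X : Set Plane}
    (h : ∀ x : Plane, ∃ ε > 0, ∀ q ∈ X, dist q x < ε → segment ℝ x q ⊆ X) :
    LocallyPathConnectedSpace X := by
  choose ε hε hst using h
  refine LocallyPathConnectedSpace.of_bases (ι := ℝ) (p := fun x r => 0 < r ∧ r ≤ ε x)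
    (s := fun x r => Metric.ball x r) ?_ ?_
  · intro x
    refine Metric.nhds_basis_ball.to_hasBasis ?_ fun r hr => ⟨r, hr.1, subset_rfl⟩
    intro r hr
    exact ⟨min r (ε x), ⟨lt_min hr (hε x), min_le_right _ _⟩,
      Metric.ball_subset_ball (min_le_left _ _)⟩
  · rintro x r ⟨hr, hrε⟩
    rw [Topology.IsInducing.subtypeVal.isPathConnected_iff]
    have himg : Subtype.val '' Metric.ball x r = X ∩ Metric.ball (x : Plane) r := by
      ext q
      constructor
      · rintro ⟨q, hq, rfl⟩
        exact ⟨q.2, hq⟩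
      · rintro ⟨hq, hd⟩
        exact ⟨⟨q, hq⟩, hd, rfl⟩
    rw [himg]
    refine StarConvex.isPathConnected (a := (x : Plane)) ?_ ⟨x.2, Metric.mem_ball_self hr⟩
    rw [starConvex_iff_segment_subset]
    rintro q ⟨hq, hd⟩
    exact Set.subset_inter (hst x q hq (lt_of_lt_of_le hd hrε))
      ((convex_ball _ _).segment_subset (Metric.mem_ball_self hr) hd)

/-- The values are discrete; a jump would force the value k + 1/2 between two integers. -/
lemma IsPreconnected.eq_of_forall_int {α : Type*} [TopologicalSpace α] {S : Set α}
    (hS : IsPreconnected S) {h : α → ℂ} (hc : ContinuousOn h S)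
    (hint : ∀ q ∈ S, ∃ k : ℤ, h q = k * (2 * Real.pi * Complex.I)) {a b : α} (ha : a ∈ S)
    (hb : b ∈ S) : h a = h b := by
  set r : α → ℝ := fun q => (h q).im / (2 * Real.pi) with hr
  have hpi : (2 * Real.pi) ≠ 0 := by positivity
  have hrk : ∀ q ∈ S, ∃ k : ℤ, r q = k ∧ h q = k * (2 * Real.pi * Complex.I) := by
    intro q hq
    obtain ⟨k, hk⟩ := hint q hq
    refine ⟨k, ?_, hk⟩
    simp only [hr, hk]
    simp
  have hrc : ContinuousOn r S := (Complex.continuous_im.comp_continuousOn hc).div_const _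
  have key : ∀ a ∈ S, ∀ b ∈ S, ¬ r a < r b := by
    intro a ha b hb hlt
    obtain ⟨k, hk, -⟩ := hrk a ha
    obtain ⟨l, hl, -⟩ := hrk b hb
    have hkl : (k : ℝ) + 1 ≤ l := by
      have : k < l := by exact_mod_cast hk ▸ hl ▸ hlt
      exact_mod_cast this
    obtain ⟨q, hq, hqr⟩ := hS.intermediate_value ha hb hrc
      (show r a + 1 / 2 ∈ Set.Icc (r a) (r b) from ⟨by linarith, by rw [hk, hl]; linarith⟩)
    obtain ⟨m, hm, -⟩ := hrk q hq
    rw [hm, hk] at hqr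
    have h1 : (m : ℝ) < k + 1 := by linarith
    have h2 : (k : ℝ) < m := by linarith
    have h3 : m < k + 1 := by exact_mod_cast h1
    have h4 : k < m := by exact_mod_cast h2
    omega
  obtain ⟨k, hk, hka⟩ := hrk a ha
  obtain ⟨l, hl, hlb⟩ := hrk b hb
  have : r a = r b := le_antisymm (not_lt.1 (key b hb a ha)) (not_lt.1 (key a ha b hb))
  rw [hk, hl] at this
  rw [hka, hlb, Int.cast_injective this]

/-- A simply connected region contains each point of the plane that two of its connected subsets
enclose. -/
lemma mem_of_enclosed {X : Set Plane} (hs : IsSimplyConnected X)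
    (hst : ∀ x : Plane, ∃ ε > 0, ∀ q ∈ X, dist q x < ε → segment ℝ x q ⊆ X)
    {n p a b : Plane} (ha : planeDet n (a - p) < 0) (hb : 0 < planeDet n (b - p))
    (han : inner ℝ n a = inner ℝ n p) (hbn : inner ℝ n b = inner ℝ n p)
    {K₁ K₂ : Set Plane} (hK₁ : IsPreconnected K₁) (hK₂ : IsPreconnected K₂)
    (hX₁ : K₁ ⊆ X) (hX₂ : K₂ ⊆ X) (ha₁ : a ∈ K₁) (hb₁ : b ∈ K₁) (ha₂ : a ∈ K₂) (hb₂ : b ∈ K₂)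
    (h₁ : ∀ q ∈ K₁, inner ℝ n p ≤ inner ℝ n q) (h₂ : ∀ q ∈ K₂, inner ℝ n q ≤ inner ℝ n p) :
    p ∈ X := by
  by_contra hp
  have hn : n ≠ 0 := by
    rintro rfl
    simp [planeDet] at ha
  have := hs.simplyConnectedSpace
  have := locallyPathConnectedSpace_of_star hst
  -- Complex coordinates centred at p, with the line through a and b as real axis: a is negative, b
  -- positive. If p is not in X, then Φ has no zero on X and has a continuous logarithm F there.
  set Φ : Plane → ℂ := fun q => ⟨planeDet n (q - p), inner ℝ n q - inner ℝ n p⟩ with hΦ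
  have hΦc : Continuous Φ := by
    have : Φ = fun q => Complex.equivRealProdCLM.symm
        (planeDet n (q - p), inner ℝ n q - inner ℝ n p) := by
      ext1 q; rfl
    rw [this]
    have := continuous_planeDet_sub n p
    fun_prop
  have hΦ0 : ∀ q ∈ X, Φ q ≠ 0 := by
    intro q hq h0
    refine hp ?_
    have h1 : planeDet n (q - p) = 0 := congrArg Complex.re h0
    have h2 : inner ℝ n q - inner ℝ n p = 0 := congrArg Complex.im h0
    have : q = p := sub_eq_zero.1
      (eq_zero_of_inner_of_planeDet hn (by rw [inner_sub_right, h2]) h1)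
    exact this ▸ hq
  have haX := hX₁ ha₁
  have hbX := hX₁ hb₁
  obtain ⟨F, ⟨-, hF⟩, -⟩ := Complex.isCoveringMapOn_exp.existsUnique_continuousMap_lifts
    (A := X) ⟨fun q => Φ q, hΦc.comp continuous_subtype_val⟩ (a₀ := ⟨a, haX⟩)
    (e₀ := Complex.log (Φ a)) (Complex.exp_log (hΦ0 a haX)) fun q => hΦ0 q q.2
  have hF' : ∀ q : X, Complex.exp (F q) = Φ q := fun q => congrFun hF q
  -- The factor c turns a half-plane containing Φ(K) into the slit plane, and d undoes the turn. So
  -- F differs from an explicit logarithm by a constant on K.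
  have branch : ∀ (c d : ℂ) (K : Set Plane), IsPreconnected K → K ⊆ X → a ∈ K → b ∈ K →
      (∀ q ∈ K, Φ q * c ∈ Complex.slitPlane) → Complex.exp d * c = 1 →
      ∀ Fa Fb : ℂ, Fa = F ⟨a, haX⟩ → Fb = F ⟨b, hbX⟩ →
      Fa - (Complex.log (Φ a * c) + d) = Fb - (Complex.log (Φ b * c) + d) := by
    rintro c d K hK hKX haK hbK hsl hcd _ _ rfl rfl
    set h : X → ℂ := fun q => F q - (Complex.log (Φ q * c) + d) with hh
    have hK' : IsPreconnected (Subtype.val ⁻¹' K : Set X) := by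
      refine Topology.IsInducing.subtypeVal.isPreconnected_image.1 ?_
      rwa [Subtype.image_preimage_val, Set.inter_eq_right.2 hKX]
    have hcon : ContinuousOn h (Subtype.val ⁻¹' K) := by
      refine F.continuous.continuousOn.sub (ContinuousOn.add ?_ continuousOn_const)
      exact ContinuousOn.clog
        ((hΦc.comp continuous_subtype_val).continuousOn.mul continuousOn_const)
        fun q hq => hsl q hq
    refine hK'.eq_of_forall_int hcon ?_ (a := ⟨a, haX⟩) (b := ⟨b, hbX⟩) haK hbK
    intro q hq
    have hc0 : c ≠ 0 := by rintro rfl; simp at hcd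
    have : Complex.exp (F q) = Complex.exp (Complex.log (Φ q * c) + d) := by
      rw [hF', Complex.exp_add, Complex.exp_log (mul_ne_zero (hΦ0 q q.2) hc0), mul_assoc,
        mul_comm c, hcd, mul_one]
    obtain ⟨k, hk⟩ := Complex.exp_eq_exp_iff_exists_int.1 this
    exact ⟨k, by rw [hh]; simp only; rw [hk]; ring⟩
  have hne : ∀ q ∈ X, (Φ q).re = 0 → (Φ q).im = 0 → False := fun q hq h1 h2 =>
    hΦ0 q hq (Complex.ext h1 h2)
  have hsl₁ : ∀ q ∈ K₁, Φ q * (-Complex.I) ∈ Complex.slitPlane := by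
    intro q hq
    have him : 0 ≤ (Φ q).im := sub_nonneg.2 (h₁ q hq)
    rw [Complex.mem_slitPlane_iff]
    rcases him.eq_or_lt with h | h
    · right
      simpa using fun h' => hne q (hX₁ hq) h' h.symm
    · left
      simpa using h
  have hsl₂ : ∀ q ∈ K₂, Φ q * Complex.I ∈ Complex.slitPlane := by
    intro q hq
    have him : (Φ q).im ≤ 0 := sub_nonpos.2 (h₂ q hq)
    rw [Complex.mem_slitPlane_iff]
    rcases him.eq_or_lt with h | h
    · right
      simpa using fun h' => hne q (hX₂ hq) h' h
    · left
      simpa using h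
  -- Apart from the same real part, F(b) - F(a) is -πi when computed along the upper set and +πi
  -- along the lower one.
  have e₁ := branch (-Complex.I) (Real.pi / 2 * Complex.I) K₁ hK₁ hX₁ ha₁ hb₁ hsl₁
    (by rw [Complex.exp_pi_div_two_mul_I]; simp) _ _ rfl rfl
  have e₂ := branch Complex.I (-(Real.pi / 2 * Complex.I)) K₂ hK₂ hX₂ ha₂ hb₂ hsl₂
    (by rw [Complex.exp_neg, Complex.exp_pi_div_two_mul_I]; simp) _ _ rfl rfl
  have hΦa : Φ a = -((-planeDet n (a - p) : ℝ) : ℂ) := by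
    apply Complex.ext <;> simp [hΦ, han]
  have hΦb : Φ b = ((planeDet n (b - p) : ℝ) : ℂ) := by
    apply Complex.ext <;> simp [hΦ, hbn]
  have ha' : 0 < -planeDet n (a - p) := by linarith
  rw [hΦa, hΦb, neg_mul_neg, Complex.log_ofReal_mul ha' Complex.I_ne_zero,
    Complex.log_ofReal_mul hb (neg_ne_zero.2 Complex.I_ne_zero), Complex.log_I,
    Complex.log_neg_I] at e₁
  rw [hΦa, hΦb, neg_mul_comm, Complex.log_ofReal_mul ha' (neg_ne_zero.2 Complex.I_ne_zero),
    Complex.log_ofReal_mul hb Complex.I_ne_zero, Complex.log_I, Complex.log_neg_I] at e₂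
  have h3 : (Real.pi : ℂ) * Complex.I = 0 := by linear_combination (e₂ - e₁) / 2
  exact mul_ne_zero (Complex.ofReal_ne_zero.2 Real.pi_ne_zero) Complex.I_ne_zero h3

lemma segment_subset_of_enclosed {X : Set Plane} (hs : IsSimplyConnected X)
    (hst : ∀ x : Plane, ∃ ε > 0, ∀ q ∈ X, dist q x < ε → segment ℝ x q ⊆ X)
    {n a b : Plane} {c : ℝ} (hn : n ≠ 0) (ha : inner ℝ n a = c) (hb : inner ℝ n b = c)
    {K₁ K₂ : Set Plane} (hK₁ : IsPreconnected K₁) (hK₂ : IsPreconnected K₂)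
    (hX₁ : K₁ ⊆ X) (hX₂ : K₂ ⊆ X) (ha₁ : a ∈ K₁) (hb₁ : b ∈ K₁) (ha₂ : a ∈ K₂) (hb₂ : b ∈ K₂)
    (h₁ : ∀ q ∈ K₁, c ≤ inner ℝ n q) (h₂ : ∀ q ∈ K₂, inner ℝ n q ≤ c) :
    segment ℝ a b ⊆ X := by
  rw [segment_eq_image']
  rintro _ ⟨θ, hθ, rfl⟩
  rcases hθ.1.eq_or_lt with rfl | hθ0
  · simpa using hX₁ ha₁
  rcases hθ.2.eq_or_lt with rfl | hθ1
  · simpa using hX₁ hb₁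
  set p := a + θ • (b - a) with hp
  have hfp : inner ℝ n p = c := by
    rw [hp, inner_add_right, inner_smul_right, inner_sub_right, ha, hb]; ring
  have hda : planeDet n (a - p) = -(θ * planeDet n (b - a)) := by
    simp [hp, planeDet]; ring
  have hdb : planeDet n (b - p) = (1 - θ) * planeDet n (b - a) := by
    simp [hp, planeDet]; ring
  have h1θ : 0 < 1 - θ := by linarith
  subst hfp
  -- The sign decides which end of the chord lies on the negative side of p; zero means a = b.
  rcases lt_trichotomy (planeDet n (b - a)) 0 with h | h | h
  · refine mem_of_enclosed hs hst ?_ ?_ hb ha hK₁ hK₂ hX₁ hX₂ hb₁ ha₁ hb₂ ha₂ h₁ h₂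
    · rw [hdb]; exact mul_neg_of_pos_of_neg h1θ h
    · rw [hda]; exact neg_pos.2 (mul_neg_of_pos_of_neg hθ0 h)
  · have hba : b - a = 0 :=
      eq_zero_of_inner_of_planeDet hn (by rw [inner_sub_right, ha, hb, sub_self]) h
    simp only [hba, smul_zero, add_zero]
    exact hX₁ ha₁
  · refine mem_of_enclosed hs hst ?_ ?_ ha hb hK₁ hK₂ hX₁ hX₂ ha₁ hb₁ ha₂ hb₂ h₁ h₂
    · rw [hda]; exact neg_neg_of_pos (mul_pos hθ0 h)
    · rw [hdb]; exact mul_pos h1θ h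

/-! ### Geodesics and uniqueness of the direction of descent. -/

namespace GapNav

variable {P : PolygonalRegion} {z : P.carrier}

/-- A piecewise linear shortest path from `x` to `z`, parametrized by its length. -/
structure IsGeodesic (z : P.carrier) (x : Plane) (A : ℝ → Plane) : Prop where
  continuous : Continuous A
  zero : A 0 = x
  mem : ∀ t ∈ Set.Icc 0 (polyDist P.carrier z x), A t ∈ P.carrier
  polyDist_eq : ∀ t ∈ Set.Icc 0 (polyDist P.carrier z x),
    polyDist P.carrier z (A t) = polyDist P.carrier z x - t
  -- One-sided straightness at each time is all the piecewise linearity that cutting a corner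
  -- requires.
  right : ∀ t ∈ Set.Ico 0 (polyDist P.carrier z x), ∃ η > 0, ∃ w : Plane, ‖w‖ = 1 ∧
    ∀ s ∈ Set.Icc 0 η, A (t + s) = A t + s • w
  left : ∀ t ∈ Set.Ioc 0 (polyDist P.carrier z x), ∃ η > 0, ∃ v : Plane, ‖v‖ = 1 ∧
    ∀ s ∈ Set.Icc 0 η, A (t - s) = A t - s • v

lemma Descends.cons {x u : Plane} {τ : ℝ} (hd : Descends z x u τ) (hu : ‖u‖ = 1) (hτ : 0 < τ)
    {A' : ℝ → Plane} (hA' : IsGeodesic z (x + τ • u) A') :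
    ∃ A, IsGeodesic z x A ∧ ∀ s ∈ Set.Icc 0 τ, A s = x + s • u := by
  set A : ℝ → Plane := fun t => if t ≤ τ then x + t • u else A' (t - τ) with hA
  have h1 : ∀ t ≤ τ, A t = x + t • u := fun t ht => if_pos ht
  have h2 : ∀ t, τ ≤ t → A t = A' (t - τ) := by
    intro t ht
    rcases ht.eq_or_lt with rfl | h
    · rw [h1 _ le_rfl, sub_self, hA'.zero]
    · exact if_neg (not_le.2 h)
  have hD := (hd τ ⟨hτ.le, le_rfl⟩).2
  refine ⟨A, ⟨?_, ?_, ?_, ?_, ?_, ?_⟩, fun s hs => h1 s hs.2⟩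
  · refine Continuous.if_le (by fun_prop) (hA'.continuous.comp (by fun_prop)) continuous_id
      continuous_const ?_
    rintro t rfl
    rw [sub_self, hA'.zero]
  · rw [h1 0 hτ.le]; simp
  · intro t ht
    rcases le_total t τ with h | h
    · rw [h1 t h]
      exact (hd t ⟨ht.1, h⟩).1
    · rw [h2 t h]
      exact hA'.mem _ ⟨by linarith, by linarith [ht.2]⟩
  · intro t ht
    rcases le_total t τ with h | h
    · rw [h1 t h, (hd t ⟨ht.1, h⟩).2]; ring
    · rw [h2 t h, hA'.polyDist_eq _ ⟨by linarith, by linarith [ht.2]⟩]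
      linarith
  · intro t ht
    rcases lt_or_ge t τ with h | h
    · refine ⟨τ - t, by linarith, u, hu, fun s hs => ?_⟩
      rw [h1 _ (by linarith [hs.2]), h1 t h.le]
      module
    · obtain ⟨η, hη, w, hw, hlin⟩ := hA'.right (t - τ) ⟨by linarith, by linarith [ht.2]⟩
      refine ⟨η, hη, w, hw, fun s hs => ?_⟩
      rw [h2 _ (by linarith [hs.1]), h2 t h, ← hlin s hs]
      congr 1; ring
  · intro t ht
    rcases le_or_gt t τ with h | h
    · refine ⟨t, ht.1, u, hu, fun s hs => ?_⟩
      rw [h1 _ (by linarith [hs.1]), h1 t h]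
      module
    · obtain ⟨η, hη, w, hw, hlin⟩ := hA'.left (t - τ) ⟨by linarith, by linarith [ht.2]⟩
      refine ⟨min η (t - τ), lt_min hη (by linarith), w, hw, fun s hs => ?_⟩
      have hs1 := hs.2.trans (min_le_left _ _)
      have hs2 := hs.2.trans (min_le_right _ _)
      rw [h2 _ (by linarith), h2 t h.le, ← hlin s ⟨hs.1, hs1⟩]
      congr 1; ring

lemma isGeodesic_const (z : P.carrier) : IsGeodesic z (z : Plane) fun _ => (z : Plane) := by
  have h0 := polyDist_self P.carrier (z : Plane)
  refine ⟨continuous_const, rfl, fun _ _ => z.2, ?_, ?_, ?_⟩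
  · intro t ht
    rw [h0] at ht ⊢
    obtain rfl : t = 0 := le_antisymm ht.2 ht.1
    simp
  · intro t ht
    rw [h0] at ht
    exact absurd ht.2 (not_lt.2 ht.1)
  · intro t ht
    rw [h0] at ht
    exact absurd ht.1 (not_lt.2 ht.2)

/-- The number of stops that are closer to `z` than `x`. -/
noncomputable def stopsAhead (z : P.carrier) (x : Plane) : ℕ :=
  {v ∈ stopSet P z | polyDist P.carrier z v < polyDist P.carrier z x}.ncard

lemma stopsAhead_lt {x y : Plane} (hy : y ∈ stopSet P z)
    (hlt : polyDist P.carrier z y < polyDist P.carrier z x) : stopsAhead z y < stopsAhead z x := by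
  refine Set.ncard_lt_ncard ?_ ((finite_stopSet z).subset (Set.sep_subset _ _))
  refine (Set.ssubset_iff_of_subset ?_).2 ⟨y, ⟨hy, hlt⟩, fun h => lt_irrefl _ h.2⟩
  exact fun v hv => ⟨hv.1, hv.2.trans hlt⟩

/-- Each descent ends at a stop with smaller d, so the number of stops ahead decreases and legs can
be joined by induction. -/
lemma exists_isGeodesic (hc : IsPreconnected P.carrier) {x : Plane} (hx : x ∈ P.carrier) :
    ∃ A, IsGeodesic z x A := by
  induction hm : stopsAhead z x using Nat.strong_induction_on generalizing x with
  | _ m ih =>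
  by_cases hxz : x = z
  · subst hxz
    exact ⟨_, isGeodesic_const z⟩
  obtain ⟨u, hu, τ, hτ, hd, hyS⟩ := exists_descends_stopSet z hc hx hxz
  have hy := hd τ ⟨hτ.le, le_rfl⟩
  obtain ⟨A', hA'⟩ := ih _ (hm ▸ stopsAhead_lt hyS (by linarith [hy.2])) hy.1 rfl
  obtain ⟨A, hA, -⟩ := hd.cons hu hτ hA'
  exact ⟨A, hA⟩

lemma Descends.exists_isGeodesic (hc : IsPreconnected P.carrier) {x u : Plane} {τ : ℝ}
    (hd : Descends z x u τ) (hu : ‖u‖ = 1) (hτ : 0 < τ) :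
    ∃ A, IsGeodesic z x A ∧ ∀ s ∈ Set.Icc 0 τ, A s = x + s • u := by
  obtain ⟨A', hA'⟩ := GapNav.exists_isGeodesic (z := z) hc (hd τ ⟨hτ.le, le_rfl⟩).1
  exact hd.cons hu hτ hA'

/-- The corner of a shortest path at a strict maximum of a linear functional on a closed curve
could be cut off. -/
lemma no_exposed_corner (hP : IsSimplyConnected P.carrier) {x : Plane} {A B : ℝ → Plane}
    (hA : IsGeodesic z x A) (hB : IsGeodesic z x B) {t₁ te : ℝ}
    (ht₁ : t₁ ≤ polyDist P.carrier z x) (hte0 : 0 < te) (hte1 : te < t₁) (hAB : A t₁ = B t₁)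
    {n : Plane} (hmaxA : ∀ t ∈ Set.Icc 0 t₁, t ≠ te → inner ℝ n (A t) < inner ℝ n (A te))
    (hmaxB : ∀ t ∈ Set.Icc 0 t₁, inner ℝ n (B t) < inner ℝ n (A te)) : False := by
  have hc : IsPreconnected P.carrier := hP.isPathConnected.isConnected.isPreconnected
  have hsubD : Set.Icc 0 t₁ ⊆ Set.Icc 0 (polyDist P.carrier z x) := Set.Icc_subset_Icc_right ht₁
  obtain ⟨η₁, hη₁, w, hw, hlinw⟩ := hA.right te ⟨hte0.le, hte1.trans_le ht₁⟩
  obtain ⟨η₂, hη₂, v, hv, hlinv⟩ := hA.left te ⟨hte0, (hte1.trans_le ht₁).le⟩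
  set η := min (min η₁ η₂) (min te (t₁ - te)) with hη
  have hη0 : 0 < η := lt_min (lt_min hη₁ hη₂) (lt_min hte0 (by linarith))
  have hηle₁ : η ≤ η₁ := (min_le_left _ _).trans (min_le_left _ _)
  have hηle₂ : η ≤ η₂ := (min_le_left _ _).trans (min_le_right _ _)
  have hηte : η ≤ te := (min_le_right _ _).trans (min_le_left _ _)
  have hηt₁ : η ≤ t₁ - te := (min_le_right _ _).trans (min_le_right _ _)
  set e := A te with he
  set f : Plane → ℝ := fun q => inner ℝ n q with hf
  have hfc : Continuous f := by fun_prop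
  have hfw : ∀ s ∈ Set.Icc 0 η, f (A (te + s)) = f e + s * f w := by
    intro s hs
    rw [hlinw s ⟨hs.1, hs.2.trans hηle₁⟩]
    simp [hf, inner_add_right, inner_smul_right]
  have hfv : ∀ s ∈ Set.Icc 0 η, f (A (te - s)) = f e - s * f v := by
    intro s hs
    rw [hlinv s ⟨hs.1, hs.2.trans hηle₂⟩]
    simp [hf, inner_sub_right, inner_smul_right]
  -- The strict maximum at e makes f rise along the incoming direction v and fall along the outgoing
  -- w; in particular v and w differ.
  have hw0 : f w < 0 := by
    have h1 := hfw η ⟨hη0.le, le_rfl⟩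
    have h2 : f (A (te + η)) < f e := hmaxA _ ⟨by linarith, by linarith⟩ (by linarith)
    by_contra! h
    have := mul_nonneg hη0.le h
    linarith
  have hv0 : 0 < f v := by
    have h1 := hfv η ⟨hη0.le, le_rfl⟩
    have h2 : f (A (te - η)) < f e := hmaxA _ ⟨by linarith, by linarith⟩ (by linarith)
    by_contra! h
    have := mul_nonneg hη0.le (neg_nonneg.2 h)
    linarith
  -- Away from the two straight pieces at e, the closed curve stays below f(e) by a positive amount.
  have hcomp : IsCompact (B '' Set.Icc 0 t₁ ∪
      A '' (Set.Icc 0 (te - η) ∪ Set.Icc (te + η) t₁)) :=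
    (isCompact_Icc.image hB.continuous).union
      ((isCompact_Icc.union isCompact_Icc).image hA.continuous)
  obtain ⟨k, hkK, hk⟩ := hcomp.exists_isMaxOn
    ⟨B 0, Or.inl ⟨0, ⟨le_rfl, by linarith⟩, rfl⟩⟩ hfc.continuousOn
  rw [isMaxOn_iff] at hk
  have hM : f k < f e := by
    rcases hkK with ⟨t, ht, rfl⟩ | ⟨t, ht | ht, rfl⟩
    · exact hmaxB t ht
    · exact hmaxA t ⟨ht.1, by linarith [ht.2]⟩ (by linarith [ht.2])
    · exact hmaxA t ⟨by linarith [ht.1], ht.2⟩ (by linarith [ht.1])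
  -- Depth of the cut: the level f(e) - δ is met on both straight pieces, at distances s and r from
  -- e, and the rest of the curve lies at or below it.
  set δ := min (f e - f k) (min (η * f v) (η * -f w)) with hδ
  have hδ0 : 0 < δ := lt_min (by linarith) (lt_min (by positivity)
    (mul_pos hη0 (neg_pos.2 hw0)))
  have hδM : δ ≤ f e - f k := min_le_left _ _
  set s := δ / f v with hs
  set r := δ / -f w with hr
  have hs0 : 0 < s := div_pos hδ0 hv0
  have hr0 : 0 < r := div_pos hδ0 (neg_pos.2 hw0)
  have hsη : s ≤ η := (div_le_iff₀ hv0).2 ((min_le_right _ _).trans (min_le_left _ _))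
  have hrη : r ≤ η := (div_le_iff₀ (neg_pos.2 hw0)).2 ((min_le_right _ _).trans (min_le_right _ _))
  have hsv : s * f v = δ := div_mul_cancel₀ _ hv0.ne'
  have hrw : r * f w = -δ := by
    have : r * -f w = δ := div_mul_cancel₀ _ (neg_pos.2 hw0).ne'
    linarith
  set a := A (te - s) with ha
  set b := A (te + r) with hb
  have hav : a = e - s • v := hlinv s ⟨hs0.le, hsη.trans hηle₂⟩
  have hbw : b = e + r • w := hlinw r ⟨hr0.le, hrη.trans hηle₁⟩
  have hfa : f a = f e - δ := by rw [ha, hfv s ⟨hs0.le, hsη⟩, hsv]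
  have hfb : f b = f e - δ := by rw [hb, hfw r ⟨hr0.le, hrη⟩, hrw]; ring
  have haI : te - s ∈ Set.Icc 0 t₁ := ⟨by linarith, by linarith⟩
  have hbI : te + r ∈ Set.Icc 0 t₁ := ⟨by linarith, by linarith⟩
  have haX : a ∈ P.carrier := hA.mem _ (hsubD haI)
  have hbX : b ∈ P.carrier := hA.mem _ (hsubD hbI)
  -- The cap above the chord from a to b, and the remainder of the closed curve, which joins a to b
  -- below it through x, B and the meeting point.
  set K₁ := A '' Set.Icc (te - s) (te + r) with hK₁
  set K₂ := A '' Set.Icc 0 (te - s) ∪ B '' Set.Icc 0 t₁ ∪ A '' Set.Icc (te + r) t₁ with hK₂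
  have hK₁c : IsPreconnected K₁ := isPreconnected_Icc.image _ hA.continuous.continuousOn
  have hK₂c : IsPreconnected K₂ := by
    refine IsPreconnected.union (B t₁) (Or.inr ⟨t₁, ⟨by linarith, le_rfl⟩, rfl⟩)
      ⟨t₁, ⟨by linarith, le_rfl⟩, hAB⟩ ?_
      (isPreconnected_Icc.image _ hA.continuous.continuousOn)
    exact IsPreconnected.union x ⟨0, ⟨le_rfl, by linarith⟩, hA.zero⟩
      ⟨0, ⟨le_rfl, by linarith⟩, hB.zero⟩ (isPreconnected_Icc.image _ hA.continuous.continuousOn)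
      (isPreconnected_Icc.image _ hB.continuous.continuousOn)
  have hK₁X : K₁ ⊆ P.carrier := by
    rintro _ ⟨t, ht, rfl⟩
    exact hA.mem _ (hsubD ⟨by linarith [ht.1], by linarith [ht.2]⟩)
  have hK₂X : K₂ ⊆ P.carrier := by
    rintro _ ((⟨t, ht, rfl⟩ | ⟨t, ht, rfl⟩) | ⟨t, ht, rfl⟩)
    · exact hA.mem _ (hsubD ⟨by linarith [ht.1], by linarith [ht.2]⟩)
    · exact hB.mem _ (hsubD ht)
    · exact hA.mem _ (hsubD ⟨by linarith [ht.1], by linarith [ht.2]⟩)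
  have hK₁f : ∀ q ∈ K₁, f e - δ ≤ f q := by
    rintro _ ⟨t, ht, rfl⟩
    rcases le_total t te with h | h
    · have h1 := hfv (te - t) ⟨by linarith, by linarith [ht.1]⟩
      rw [sub_sub_cancel] at h1
      have := mul_le_mul_of_nonneg_right (show te - t ≤ s by linarith [ht.1]) hv0.le
      linarith
    · have h1 := hfw (t - te) ⟨by linarith, by linarith [ht.2]⟩
      rw [add_sub_cancel] at h1
      have := mul_le_mul_of_nonpos_right (show t - te ≤ r by linarith [ht.2]) hw0.le
      linarith
  have hK₂f : ∀ q ∈ K₂, f q ≤ f e - δ := by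
    rintro _ ((⟨t, ht, rfl⟩ | ⟨t, ht, rfl⟩) | ⟨t, ht, rfl⟩)
    · rcases le_total t (te - η) with h | h
      · linarith [hk _ (Or.inr ⟨t, Or.inl ⟨ht.1, h⟩, rfl⟩)]
      · have h1 := hfv (te - t) ⟨by linarith [ht.2], by linarith⟩
        rw [sub_sub_cancel] at h1
        have := mul_le_mul_of_nonneg_right (show s ≤ te - t by linarith [ht.2]) hv0.le
        linarith
    · linarith [hk _ (Or.inl ⟨t, ht, rfl⟩)]
    · rcases le_total (te + η) t with h | h
      · linarith [hk _ (Or.inr ⟨t, Or.inr ⟨h, ht.2⟩, rfl⟩)]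
      · have h1 := hfw (t - te) ⟨by linarith [ht.1], by linarith⟩
        rw [add_sub_cancel] at h1
        have := mul_le_mul_of_nonpos_right (show r ≤ t - te by linarith [ht.1]) hw0.le
        linarith
  have ha₁ : a ∈ K₁ := ⟨_, ⟨le_rfl, by linarith⟩, rfl⟩
  have hb₁ : b ∈ K₁ := ⟨_, ⟨by linarith, le_rfl⟩, rfl⟩
  have ha₂ : a ∈ K₂ := Or.inl (Or.inl ⟨_, ⟨by linarith, le_rfl⟩, rfl⟩)
  have hb₂ : b ∈ K₂ := Or.inr ⟨_, ⟨le_rfl, by linarith⟩, rfl⟩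
  have hn : n ≠ 0 := by
    rintro rfl
    simp [hf] at hv0
  have hseg : segment ℝ a b ⊆ P.carrier :=
    segment_subset_of_enclosed hP P.exists_star hn hfa hfb hK₁c hK₂c hK₁X hK₂X ha₁ hb₁ ha₂ hb₂
      hK₁f hK₂f
  have h1 := polyDist_le_add z hc hseg
  rw [hA.polyDist_eq _ (hsubD haI), hA.polyDist_eq _ (hsubD hbI)] at h1
  -- The chord is strictly shorter than the corner, contradicting the drop s + r of d from a to b.
  have h2 : dist a b < s + r := by
    rw [dist_comm, dist_eq_norm, hav, hbw, show e + r • w - (e - s • v) = s • v + r • w by abel]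
    have h3 := norm_add_lt_of_not_sameRay (x := s • v) (y := r • w) fun h => by
      have h4 := (((SameRay.sameRay_nonneg_smul_left v hs0.le).symm.trans h fun h0 =>
        absurd h0 (smul_ne_zero hs0.ne' (by rintro rfl; simp at hv))).trans
        (SameRay.sameRay_nonneg_smul_left w hr0.le) fun h0 =>
        absurd h0 (smul_ne_zero hr0.ne' (by rintro rfl; simp at hw)))
      have h5 := h4.eq_of_norm_eq (hv.trans hw.symm)
      rw [h5] at hv0
      linarith
    rwa [norm_smul, norm_smul, hv, hw, Real.norm_of_nonneg hs0.le, Real.norm_of_nonneg hr0.le,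
      mul_one, mul_one] at h3
  linarith

end GapNav

namespace GapNav

variable {P : PolygonalRegion} {z : P.carrier}

/-- Two shortest paths that meet only at the end points cannot reach farther from a point `o` than
their end points do. -/
lemma not_farthest (hP : IsSimplyConnected P.carrier) {x : Plane} {A B : ℝ → Plane}
    (hA : IsGeodesic z x A) (hB : IsGeodesic z x B) {t₁ te : ℝ}
    (ht₁ : t₁ ≤ polyDist P.carrier z x) (hAB : A t₁ = B t₁)
    (hne : ∀ t, 0 < t → t < t₁ → A t ≠ B t) (hte : te ∈ Set.Icc 0 t₁) {o : Plane}
    (hmax : ∀ t ∈ Set.Icc 0 t₁, dist (A t) o ≤ dist (A te) o ∧ dist (B t) o ≤ dist (A te) o)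
    (h0 : dist x o < dist (A te) o) (h1 : dist (A t₁) o < dist (A te) o) : False := by
  have hsubD : Set.Icc 0 t₁ ⊆ Set.Icc 0 (polyDist P.carrier z x) := Set.Icc_subset_Icc_right ht₁
  have hte0 : 0 < te := by
    refine hte.1.lt_of_ne ?_
    rintro rfl
    rw [hA.zero] at h0
    exact lt_irrefl _ h0
  have hte1 : te < t₁ := by
    refine hte.2.lt_of_ne ?_
    rintro rfl
    exact lt_irrefl _ h1
  -- On every geodesic from x the value of d determines the time.
  have hinj : ∀ (C : ℝ → Plane), IsGeodesic z x C → ∀ t ∈ Set.Icc 0 t₁, C t = A te → t = te := by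
    intro C hC t ht h
    have h2 := hC.polyDist_eq t (hsubD ht)
    rw [h, hA.polyDist_eq te (hsubD hte)] at h2
    linarith
  -- Balls are strictly convex: a tangent line touches the ball around o only at `A te`, so a
  -- farthest point is a strict maximum of a linear functional.
  have key : ∀ q : Plane, dist q o ≤ dist (A te) o → q ≠ A te →
      inner ℝ (A te - o) q < inner ℝ (A te - o) (A te) := by
    intro q hq hqe
    rw [dist_eq_norm, dist_eq_norm] at hq
    have h2 : q - o = (A te - o) + (q - A te) := by abel
    have h3 := norm_add_sq_real (A te - o) (q - A te)
    rw [← h2, inner_sub_right] at h3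
    have h4 : 0 < ‖q - A te‖ := norm_pos_iff.2 (sub_ne_zero.2 hqe)
    have h5 := pow_le_pow_left₀ (norm_nonneg _) hq 2
    nlinarith
  refine no_exposed_corner hP hA hB ht₁ hte0 hte1 hAB (n := A te - o) ?_ ?_
  · exact fun t ht htne => key _ (hmax t ht).1 fun h => htne (hinj A hA t ht h)
  · refine fun t ht => key _ (hmax t ht).2 fun h => ?_
    obtain rfl := hinj B hB t ht h
    exact hne t hte0 hte1 h.symm

/-- Shortest paths with the same end points that meet only there do not leave the line through
the end points. -/
lemma planeDet_eq_zero_of_meet (hP : IsSimplyConnected P.carrier) {x : Plane} {A B : ℝ → Plane}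
    (hA : IsGeodesic z x A) (hB : IsGeodesic z x B) {t₁ : ℝ}
    (ht₁ : t₁ ≤ polyDist P.carrier z x) (hAB : A t₁ = B t₁)
    (hne : ∀ t, 0 < t → t < t₁ → A t ≠ B t) {t : ℝ} (ht : t ∈ Set.Icc 0 t₁) :
    planeDet (A t₁ - x) (A t - x) = 0 := by
  by_contra hσ
  set d := A t₁ - x with hd
  set q := A t with hq
  set σ := planeDet d (q - x) with hσdef
  -- A normal to the chord d; the factor σ turns it to the side of q.
  obtain ⟨N, hNd, hNq⟩ : ∃ N : Plane, inner ℝ N d = 0 ∧ 0 < inner ℝ N (q - x) := by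
    refine ⟨σ • !₂[-d 1, d 0], ?_, ?_⟩
    · simp only [inner_smul_left, PiLp.inner_apply, Fin.sum_univ_two, RCLike.inner_apply,
        conj_trivial]
      simp; right; ring
    · have : inner ℝ (σ • !₂[-d 1, d 0]) (q - x) = σ * σ := by
        simp only [inner_smul_left, PiLp.inner_apply, Fin.sum_univ_two, RCLike.inner_apply,
          conj_trivial]
        simp [hσdef, planeDet]; left; ring
      rw [this]
      exact mul_self_pos.2 hσ
  set r := inner ℝ N (q - x) with hr
  -- The centre o is moved so far to the other side of the chord that q is farther from it than both
  -- ends.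
  set lam := ‖d‖ ^ 2 / r + 1 with hlam
  have hlam0 : 0 < lam := by positivity
  have hlamr : ‖d‖ ^ 2 < lam * r := by
    rw [hlam, add_mul, div_mul_cancel₀ _ hNq.ne']; linarith
  set o := x - lam • N with ho
  have hdist : ∀ y : Plane, dist y o ^ 2 =
      ‖y - x‖ ^ 2 + 2 * (lam * inner ℝ N (y - x)) + ‖lam • N‖ ^ 2 := by
    intro y
    rw [dist_eq_norm, show y - o = (y - x) + lam • N by rw [ho]; abel, norm_add_sq_real,
      inner_smul_right, real_inner_comm]
  have hxo := hdist x
  have hzo := hdist (A t₁)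
  have hqo := hdist q
  rw [sub_self, norm_zero, inner_zero_right] at hxo
  rw [← hd, hNd] at hzo
  rw [← hr] at hqo
  have hxq : dist x o < dist q o := by
    refine lt_of_pow_lt_pow_left₀ 2 dist_nonneg ?_
    have := mul_pos hlam0 hNq
    nlinarith [sq_nonneg ‖q - x‖]
  have hzq : dist (A t₁) o < dist q o := by
    refine lt_of_pow_lt_pow_left₀ 2 dist_nonneg ?_
    nlinarith [sq_nonneg ‖q - x‖, sq_nonneg ‖d‖]
  have hcomp : IsCompact (A '' Set.Icc 0 t₁ ∪ B '' Set.Icc 0 t₁) :=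
    (isCompact_Icc.image hA.continuous).union (isCompact_Icc.image hB.continuous)
  obtain ⟨e, he, hmax⟩ := hcomp.exists_isMaxOn ⟨q, Or.inl ⟨t, ht, rfl⟩⟩
    (f := fun y => dist y o) (by fun_prop)
  rw [isMaxOn_iff] at hmax
  have hqe := hmax q (Or.inl ⟨t, ht, rfl⟩)
  have hA' : ∀ s ∈ Set.Icc 0 t₁, dist (A s) o ≤ dist e o := fun s hs => hmax _ (Or.inl ⟨s, hs, rfl⟩)
  have hB' : ∀ s ∈ Set.Icc 0 t₁, dist (B s) o ≤ dist e o := fun s hs => hmax _ (Or.inr ⟨s, hs, rfl⟩)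
  rcases he with ⟨te, hte, rfl⟩ | ⟨te, hte, rfl⟩
  · exact not_farthest hP hA hB ht₁ hAB hne hte (fun s hs => ⟨hA' s hs, hB' s hs⟩)
      (hxq.trans_le hqe) (hzq.trans_le hqe)
  · exact not_farthest hP hB hA ht₁ hAB.symm (fun s h0 h1 => (hne s h0 h1).symm) hte
      (fun s hs => ⟨hB' s hs, hA' s hs⟩) (hxq.trans_le hqe) (hAB ▸ hzq.trans_le hqe)

/-- In a simply connected region the direction of the shortest paths from `x` to `z` is unique. -/
lemma Descends.unique (hP : IsSimplyConnected P.carrier) {x u u' : Plane} {τ τ' : ℝ}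
    (h : Descends z x u τ) (h' : Descends z x u' τ') (hu : ‖u‖ = 1) (hu' : ‖u'‖ = 1)
    (hτ : 0 < τ) (hτ' : 0 < τ') : u = u' := by
  by_contra hne
  have hc : IsPreconnected P.carrier := hP.isPathConnected.isConnected.isPreconnected
  obtain ⟨A, hA, hAu⟩ := h.exists_isGeodesic hc hu hτ
  obtain ⟨B, hB, hBu⟩ := h'.exists_isGeodesic hc hu' hτ'
  set D := polyDist P.carrier z x with hD
  have hτD : τ ≤ D := by
    have := (h τ ⟨hτ.le, le_rfl⟩).2
    linarith [polyDist_nonneg P.carrier z (x + τ • u)]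
  have hend : ∀ C, IsGeodesic z x C → C D = z := by
    intro C hC
    have hDm : D ∈ Set.Icc 0 D := ⟨polyDist_nonneg _ _ _, le_rfl⟩
    have h1 := dist_le_polyDist z hc (hC.mem D hDm)
    rw [hC.polyDist_eq D hDm, ← hD, sub_self] at h1
    exact dist_le_zero.1 h1
  set τ₀ := min τ τ' with hτ₀
  have hτ₀0 : 0 < τ₀ := lt_min hτ hτ'
  -- The earliest meeting after the straight beginnings, where the paths differ; both end at the
  -- goal, so one exists.
  have hcomp : IsCompact {t | t ∈ Set.Icc τ₀ D ∧ A t = B t} :=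
    isCompact_Icc.inter_right (isClosed_eq hA.continuous hB.continuous)
  obtain ⟨t₁, ⟨ht₁, hAB⟩, hmin⟩ := hcomp.exists_isLeast
    ⟨D, ⟨(min_le_left _ _).trans hτD, le_rfl⟩, (hend A hA).trans (hend B hB).symm⟩
  have ht₁0 : 0 < t₁ := hτ₀0.trans_le ht₁.1
  have hmeet : ∀ t, 0 < t → t < t₁ → A t ≠ B t := by
    intro t ht0 htt hABt
    rcases le_total t τ₀ with hle | hle
    · rw [hAu t ⟨ht0.le, hle.trans (min_le_left _ _)⟩,
        hBu t ⟨ht0.le, hle.trans (min_le_right _ _)⟩] at hABt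
      exact hne (smul_right_injective _ ht0.ne' (add_left_cancel hABt))
    · exact absurd (hmin ⟨⟨hle, htt.le.trans ht₁.2⟩, hABt⟩) (not_le.2 htt)
  have hlineA := fun t ht => planeDet_eq_zero_of_meet hP hA hB ht₁.2 hAB hmeet (t := t) ht
  have hlineB := fun t ht => planeDet_eq_zero_of_meet hP hB hA ht₁.2 hAB.symm
    (fun s h0 h1 => (hmeet s h0 h1).symm) (t := t) ht
  rw [← hAB] at hlineB
  set d := A t₁ - x with hd
  have hd0 : d ≠ 0 := by
    intro h0
    have h1 := hA.polyDist_eq t₁ ⟨ht₁0.le, ht₁.2⟩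
    rw [sub_eq_zero.1 h0] at h1
    linarith
  -- Both paths stay on the line of d, so each passes through the midpoint of the chord, and at the
  -- same time as d has the same value there.
  have hmid : ∀ C, IsGeodesic z x C → C t₁ = A t₁ → ∃ t ∈ Set.Icc 0 t₁,
      inner ℝ d (C t - x) = inner ℝ d d / 2 := by
    intro C hC hCt
    refine intermediate_value_Icc ht₁0.le (f := fun t => inner ℝ d (C t - x)) ?_ ?_
    · have := hC.continuous
      fun_prop
    · have : 0 ≤ inner ℝ d d := real_inner_self_nonneg
      simp only [hC.zero, sub_self, inner_zero_right, hCt, ← hd]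
      constructor <;> linarith
  obtain ⟨t, ht, htm⟩ := hmid A hA rfl
  obtain ⟨s, hs, hsm⟩ := hmid B hB hAB.symm
  have hdet : planeDet d (A t - B s) = 0 := by
    have : planeDet d (A t - B s) = planeDet d (A t - x) - planeDet d (B s - x) := by
      simp [planeDet]; ring
    rw [this, hlineA t ht, hlineB s hs, sub_self]
  have hABts : A t = B s := by
    refine sub_eq_zero.1 (eq_zero_of_inner_of_planeDet hd0 ?_ hdet)
    rw [show A t - B s = (A t - x) - (B s - x) by abel, inner_sub_right, htm, hsm, sub_self]
  have hts : t = s := by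
    have h1 := hA.polyDist_eq t ⟨ht.1, ht.2.trans ht₁.2⟩
    rw [hABts, hB.polyDist_eq s ⟨hs.1, hs.2.trans ht₁.2⟩] at h1
    linarith
  subst hts
  have hdd : 0 < inner ℝ d d := real_inner_self_pos.2 hd0
  have ht0 : t ≠ 0 := by
    rintro rfl
    rw [hA.zero, sub_self, inner_zero_right] at htm
    linarith
  have ht1 : t ≠ t₁ := by
    rintro rfl
    rw [← hd] at htm
    linarith
  exact hmeet t (ht.1.lt_of_ne ht0.symm) (ht.2.lt_of_ne ht1) hABts

/-- A move along a shortest path descends all the way. -/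
lemma GreedyMove.descends (hc : IsPreconnected P.carrier) {x y : P.carrier} {u : Real.Angle}
    (h : GreedyMove z x u y) : Descends z x (vel u) (dist (x : Plane) y) := by
  obtain ⟨⟨t, ht, hy, hseg, -, -⟩, hg⟩ := h
  have hd : dist (x : Plane) y = t := by
    have := dist_ray (x := (x : Plane)) (norm_vel u) 0 t
    rwa [zero_smul, add_zero, ← hy, zero_sub, abs_neg, abs_of_pos ht] at this
  rw [hd] at hg ⊢
  have hray : ∀ a b, 0 ≤ a → a ≤ b → b ≤ t →
      segment ℝ ((x : Plane) + a • vel u) (x + b • vel u) ⊆ P.carrier := by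
    intro a b ha hab hb
    refine subset_trans ?_ hseg
    have h2 := segment_ray (x := (x : Plane)) (u := vel u) ht.le
    rw [zero_smul, add_zero, ← hy] at h2
    rw [segment_ray hab, h2]
    exact Set.image_mono (Set.Icc_subset_Icc ha hb)
  intro s hs
  have h1 := polyDist_le_add z hc (hray 0 s le_rfl hs.1 hs.2)
  have h2 := polyDist_le_add z hc (hray s t hs.1 hs.2 le_rfl)
  rw [dist_ray (norm_vel u), abs_of_nonpos (by linarith [hs.1])] at h1
  rw [dist_ray (norm_vel u), abs_of_nonpos (by linarith [hs.2]), ← hy] at h2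
  rw [zero_smul, add_zero] at h1
  exact ⟨hray s t hs.1 hs.2 le_rfl (left_mem_segment ℝ _ _), by linarith⟩

lemma GreedyMove.pos {x y : P.carrier} {u : Real.Angle} (h : GreedyMove z x u y) :
    0 < dist (x : Plane) y := by
  obtain ⟨⟨t, ht, hy, -⟩, -⟩ := h
  have := dist_ray (x := (x : Plane)) (norm_vel u) 0 t
  rw [zero_smul, add_zero, ← hy, zero_sub, abs_neg, abs_of_pos ht] at this
  rwa [this]

lemma GreedyMove.unique (hP : IsSimplyConnected P.carrier) {x y y' : P.carrier}
    {u u' : Real.Angle} (h : GreedyMove z x u y) (h' : GreedyMove z x u' y') : u = u' := by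
  have hc : IsPreconnected P.carrier := hP.isPathConnected.isConnected.isPreconnected
  exact vel_injective ((h.descends hc).unique hP (h'.descends hc) (norm_vel u) (norm_vel u')
    h.pos h'.pos)

end GapNav

/-! ### Optimal policies are the greedy ones. -/

namespace GapNav

variable {P : PolygonalRegion} {z : P.carrier}

lemma Moves.unique {x y y' : P.carrier} {u : Real.Angle} (h : Moves P z x u y)
    (h' : Moves P z x u y') : y = y' := by
  obtain ⟨t, ht, hy, -, hs, hf⟩ := h
  obtain ⟨t', ht', hy', -, hs', hf'⟩ := h'
  rcases lt_trichotomy t t' with hlt | rfl | hlt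
  · exact absurd (hy ▸ hs) (hf' t ⟨ht, hlt⟩)
  · exact Subtype.ext (hy.trans hy'.symm)
  · exact absurd (hy' ▸ hs') (hf t' ⟨ht', hlt⟩)

lemma Moves.transition_eq {x y : P.carrier} {u : Real.Angle} (h : Moves P z x u y) :
    transition P z x u = y := by
  have hex : ∃ y, Moves P z x u y := ⟨y, h⟩
  rw [transition, dif_pos hex]
  exact hex.choose_spec.unique h

lemma segment_transition_subset (x : P.carrier) (u : Real.Angle) :
    segment ℝ (x : Plane) (transition P z x u) ⊆ P.carrier := by
  by_cases hex : ∃ y, Moves P z x u y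
  · obtain ⟨y, hy⟩ := hex
    rw [hy.transition_eq]
    obtain ⟨_, _, _, h, _⟩ := hy
    exact h
  · rw [transition, dif_neg hex, segment_same, Set.singleton_subset_iff]
    exact x.2

variable (π : StatePolicy P z)

lemma run_goal (k : ℕ) : run P z π z k = z := by
  induction k with
  | zero => rfl
  | succ k ih => rw [run, dif_pos ih]

lemma run_one {x : P.carrier} (hx : x ≠ z) :
    run P z π x 1 = transition P z x (π ⟨x, hx⟩) := by
  rw [run, dif_neg (by exact hx)]
  rfl

lemma run_succ_eq (x : P.carrier) (k : ℕ) :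
    run P z π x (k + 1) = run P z π (run P z π x 1) k := by
  induction k with
  | zero => rfl
  | succ k ih =>
    have hs : ∀ y j, run P z π y (j + 1) = if h : run P z π y j = z then z
        else transition P z (run P z π y j) (π ⟨run P z π y j, h⟩) := fun _ _ => rfl
    rw [hs x (k + 1), hs (run P z π x 1) k]
    simp only [ih]

lemma runLength_succ (x : P.carrier) (N : ℕ) : runLength P z π x (N + 1) =
    dist (x : Plane) (run P z π x 1) + runLength P z π (run P z π x 1) N := by
  rw [runLength, Finset.sum_range_succ', add_comm, runLength]
  congr 1
  refine Finset.sum_congr rfl fun k _ => ?_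
  rw [run_succ_eq π x (k + 1), run_succ_eq π x k]

lemma polyReach_run (N : ℕ) : ∀ x : P.carrier, run P z π x N = z →
    PolyReach P.carrier z x (runLength P z π x N) := by
  induction N with
  | zero =>
    intro x hx
    have hxz : x = z := hx
    rw [hxz]
    simpa [runLength] using PolyReach.refl
  | succ N ih =>
    intro x hx
    rw [run_succ_eq] at hx
    rw [runLength_succ]
    refine PolyReach.step ?_ (ih _ hx)
    by_cases hxz : x = z
    · subst hxz
      rw [run_goal, segment_same, Set.singleton_subset_iff]
      exact x.2
    · rw [run_one π hxz]
      exact segment_transition_subset x _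

variable {π}

/-- Termination: every greedy move ends at a stop strictly closer to the goal, and the lengths
telescope to d. -/
lemma exists_run_eq_of_greedy (hπ : ∀ x : ActiveState P z, ∃ y, GreedyMove z x.1 (π x) y)
    (x : P.carrier) :
    ∃ N, run P z π x N = z ∧ runLength P z π x N = polyDist P.carrier z x := by
  induction hm : stopsAhead z (x : Plane) using Nat.strong_induction_on generalizing x with
  | _ m ih =>
  by_cases hxz : x = z
  · subst hxz
    exact ⟨0, rfl, by rw [polyDist_self]; simp [runLength]⟩
  obtain ⟨y, hy⟩ := hπ ⟨x, hxz⟩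
  have hlt : polyDist P.carrier z y < polyDist P.carrier z x := by
    have := hy.pos
    linarith [hy.2]
  have hyS : (y : Plane) ∈ stopSet P z := by
    obtain ⟨_, _, _, _, h, _⟩ := hy.1
    exact h
  obtain ⟨N, hN, hL⟩ := ih _ (hm ▸ stopsAhead_lt hyS hlt) y rfl
  have h1 : run P z π x 1 = y := (run_one π hxz).trans hy.1.transition_eq
  refine ⟨N + 1, by rw [run_succ_eq, h1, hN], ?_⟩
  rw [runLength_succ, h1, hL]
  exact hy.2.symm

lemma exists_greedyPolicy (hc : IsPreconnected P.carrier) (z : P.carrier) :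
    ∃ π : StatePolicy P z, ∀ x : ActiveState P z, ∃ y, GreedyMove z x.1 (π x) y := by
  choose π hπ using fun x : ActiveState P z => exists_greedyMove z hc x.2
  exact ⟨π, hπ⟩

lemma isLeast_polyDist (hc : IsPreconnected P.carrier) (x : P.carrier) :
    IsLeast (arrivalTimes P x z) (polyDist P.carrier z x) := by
  refine ⟨?_, fun T hT => polyDist_le_of_mem_arrivalTimes z hc hT⟩
  obtain ⟨π, hπ⟩ := exists_greedyPolicy hc z
  obtain ⟨N, hN, hL⟩ := exists_run_eq_of_greedy hπ x
  rw [← hL]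
  exact polyReach_mem_arrivalTimes P z (polyReach_run π N x hN) x.2

lemma isDistanceOptimal_of_greedy (hc : IsPreconnected P.carrier)
    (hπ : ∀ x : ActiveState P z, ∃ y, GreedyMove z x.1 (π x) y) : IsDistanceOptimal P z π := by
  intro x
  obtain ⟨N, hN, hL⟩ := exists_run_eq_of_greedy hπ x
  exact ⟨N, hN, hL ▸ isLeast_polyDist hc x⟩

/-- The rest of an optimal run is a polyline from y, so its length is at least d(y), which forces
equality in the triangle inequality. An action that does not move would be repeated forever. -/
lemma IsDistanceOptimal.greedy (hc : IsPreconnected P.carrier) (hπ : IsDistanceOptimal P z π)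
    (x : ActiveState P z) : ∃ y, GreedyMove z x.1 (π x) y := by
  obtain ⟨x, hx⟩ := x
  obtain ⟨N, hN, hL⟩ := hπ x
  by_cases hex : ∃ y, Moves P z x (π ⟨x, hx⟩) y
  · obtain ⟨y, hy⟩ := hex
    refine ⟨y, hy, ?_⟩
    have h1 : run P z π x 1 = y := (run_one π hx).trans hy.transition_eq
    obtain _ | N := N
    · exact absurd hN hx
    have hg := hL.unique (isLeast_polyDist hc x)
    rw [runLength_succ, h1] at hg
    rw [run_succ_eq, h1] at hN
    have h2 := (polyReach_run π N y hN).polyDist_le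
    obtain ⟨_, _, _, hseg, _⟩ := hy
    have h3 := polyDist_le_add z hc hseg
    linarith
  · exfalso
    have hstay : run P z π x 1 = x := by rw [run_one π hx, transition, dif_neg hex]
    have : ∀ k, run P z π x k = x := by
      intro k
      induction k with
      | zero => rfl
      | succ k ih => rw [run_succ_eq, hstay, ih]
    exact hx ((this N).symm.trans hN)

/-- There is exactly one distance-optimal state policy. -/
lemma existsUnique_isDistanceOptimal (hP : IsSimplyConnected P.carrier) :
    ∃! π : StatePolicy P z, IsDistanceOptimal P z π := by
  have hc : IsPreconnected P.carrier := hP.isPathConnected.isConnected.isPreconnected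
  obtain ⟨π, hπ⟩ := exists_greedyPolicy hc z
  refine ⟨π, isDistanceOptimal_of_greedy hc hπ, fun π' hπ' => funext fun x => ?_⟩
  obtain ⟨y, hy⟩ := hπ x
  obtain ⟨y', hy'⟩ := hπ'.greedy hc x
  exact hy'.unique hP hy

/-- A greedy move at a point that sees the goal is directed to the goal. -/
lemma GreedyMove.exists_smul_eq (hc : IsPreconnected P.carrier) {x y : P.carrier} {u : Real.Angle}
    (h : GreedyMove z x u y) (hseg : segment ℝ (x : Plane) z ⊆ P.carrier) :
    ∃ c : ℝ, (z : Plane) - x = c • vel u := by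
  have h1 := polyDist_le_add z hc hseg
  rw [polyDist_self, add_zero, h.2] at h1
  have h2 := dist_le_polyDist z hc y.2
  -- Equality in the triangle inequality puts y on the segment from x to the goal.
  have h3 : dist (x : Plane) y + dist (y : Plane) z = dist (x : Plane) z :=
    le_antisymm (by linarith) (dist_triangle _ _ _)
  have hy0 := h.pos
  have hmem := (dist_add_dist_eq_iff.1 h3).mem_segment
  obtain ⟨⟨t, ht, hy, -⟩, -⟩ := h
  rw [segment_eq_image'] at hmem
  obtain ⟨θ, -, hθ⟩ := hmem
  simp only [hy] at hθ
  have h4 : θ • ((z : Plane) - x) = t • vel u := add_left_cancel hθ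
  have hθ0 : θ ≠ 0 := by
    rintro rfl
    rw [zero_smul] at h4
    have h5 := congrArg norm h4.symm
    rw [norm_smul, norm_vel, norm_zero, mul_one, norm_eq_zero] at h5
    exact ht.ne' h5
  exact ⟨θ⁻¹ * t, by rw [mul_smul, ← h4, inv_smul_smul₀ hθ0]⟩

/-! ### Insufficiency of the gap sensor. -/

/-- There are finitely many gap identities, hence countably many lists of them, and every
observation is the image of such a list, even if L is uncountable. -/
lemma countable_range_gapSensor (P : PolygonalRegion) {L : Type*} (label : GapId P → L) :
    (Set.range (gapSensor P label)).Countable := by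
  have hcount : (Set.range fun l : List (GapId P) => (l.map label : Cycle L)).Countable :=
    Set.countable_range _
  refine hcount.mono ?_
  rintro _ ⟨x, rfl⟩
  by_cases hf : (gapDirections P x).Finite
  · refine ⟨(hf.toFinset.sort (· ≤ ·)).map (gapId P x), ?_⟩
    rw [gapSensor, dif_pos hf]
    simp [List.map_map, Function.comp_def]
  · refine ⟨[], ?_⟩
    rw [gapSensor, dif_neg hf]
    rfl

lemma not_refines_gapSensor (hc : IsPreconnected P.carrier) {L : Type*} (label : GapId P → L)
    (hπ : IsDistanceOptimal P z π) :
    ¬ Refines (fun x : ActiveState P z => gapSensor P label x) π := by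
  intro href
  obtain ⟨q₀, δ, hδ, hq₀, hvis⟩ := P.exists_visible_ball z.2
  set d : Plane := q₀ - z with hd
  have hd0 : d ≠ 0 := sub_ne_zero.2 hq₀
  set n : Plane := !₂[-d 1, d 0] with hn
  have hdn : planeDet d n ≠ 0 := by
    intro h
    refine hd0 (eq_zero_of_inner_of_planeDet hd0 ?_ (by simp [planeDet]; ring))
    simp only [hn, planeDet, PiLp.inner_apply, Fin.sum_univ_two, RCLike.inner_apply,
      conj_trivial] at h ⊢
    simpa using h
  -- Parameters of points visible from the goal on a line across the direction d; as a nonempty open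
  -- set, I is uncountable.
  set I : Set ℝ := (fun s : ℝ => q₀ + s • n) ⁻¹' (Metric.ball q₀ δ ∩ {(z : Plane)}ᶜ) with hI
  have hIo : IsOpen I :=
    (Metric.isOpen_ball.inter isOpen_compl_singleton).preimage (by fun_prop)
  have hIne : I.Nonempty := ⟨0, by simpa [hI, hδ] using hq₀⟩
  have hIunc : ¬ I.Countable := by
    intro h
    have h1 := hIo.measure_pos MeasureTheory.volume hIne
    rw [h.measure_zero] at h1
    exact lt_irrefl _ h1
  have hIX : ∀ s : I, q₀ + (s : ℝ) • n ∈ P.carrier := fun s =>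
    hvis _ s.2.1 (right_mem_segment ℝ _ _)
  set pt : I → ActiveState P z := fun s =>
    ⟨⟨q₀ + (s : ℝ) • n, hIX s⟩, fun h => s.2.2 (congrArg Subtype.val h)⟩ with hpt
  -- Equal observations would give equal actions by refinement, but the lines from these points to
  -- the goal are pairwise different.
  have hinj : Function.Injective fun s : I => (⟨gapSensor P label (pt s).1, _, rfl⟩ :
      Set.range (gapSensor P label)) := by
    intro s s' hss
    have hss' : gapSensor P label (pt s).1 = gapSensor P label (pt s').1 :=
      congrArg Subtype.val hss
    obtain ⟨D, ⟨i, rfl⟩, hD⟩ := href _ ⟨pt s', rfl⟩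
    have hs := hD (show pt s ∈ _ from hss')
    have hs' := hD (show pt s' ∈ _ from rfl)
    have heq : π (pt s) = π (pt s') := Eq.trans hs (Eq.symm hs')
    have hdir : ∀ r : I, ∃ c : ℝ, (z : Plane) - (q₀ + (r : ℝ) • n) = c • vel (π (pt r)) := by
      intro r
      obtain ⟨y, hy⟩ := hπ.greedy hc (pt r)
      exact hy.exists_smul_eq hc (segment_symm ℝ (z : Plane) _ ▸ hvis _ r.2.1)
    obtain ⟨c, hcs⟩ := hdir s
    obtain ⟨c', hcs'⟩ := hdir s'
    rw [heq] at hcs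
    have hdet : planeDet ((z : Plane) - (q₀ + (s : ℝ) • n)) (z - (q₀ + (s' : ℝ) • n)) = 0 := by
      rw [hcs, hcs']; simp [planeDet]; ring
    have hdet' : planeDet ((z : Plane) - (q₀ + (s : ℝ) • n)) (z - (q₀ + (s' : ℝ) • n)) =
        ((s' : ℝ) - s) * planeDet d n := by
      simp only [planeDet, hd, PiLp.sub_apply, PiLp.add_apply, PiLp.smul_apply, smul_eq_mul]
      ring
    rw [hdet'] at hdet
    exact Subtype.ext (sub_eq_zero.1 ((mul_eq_zero.1 hdet).resolve_right hdn)).symm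
  have := (countable_range_gapSensor P label).to_subtype
  exact hIunc (Set.countable_coe_iff.1 hinj.countable)

end GapNav

theorem mainTheorem10 (P : GapNav.PolygonalRegion) (hP : IsSimplyConnected P.carrier)
    (xG : P.carrier) {L : Type*} (label : GapNav.GapId P → L) :
    (∃! π : GapNav.StatePolicy P xG, GapNav.IsDistanceOptimal P xG π) ∧
    (∀ π : GapNav.StatePolicy P xG, GapNav.IsDistanceOptimal P xG π →
      ¬ GapNav.Refines (fun x : GapNav.ActiveState P xG => GapNav.gapSensor P label x) π) ∧
    ¬ GapNav.SufficientForReactive P xG (GapNav.gapSensor P label) := by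
  have hc : IsPreconnected P.carrier := hP.isPathConnected.isConnected.isPreconnected
  refine ⟨existsUnique_isDistanceOptimal hP, fun π hπ => not_refines_gapSensor hc label hπ, ?_⟩
  rintro ⟨πY, hπ⟩
  -- A policy that factors through the sensor is constant on each class of observations, so the
  -- sensor would refine it.
  refine not_refines_gapSensor hc label hπ ?_
  rintro _ ⟨i, rfl⟩
  exact ⟨_, ⟨i, rfl⟩, fun j hj => congrArg πY hj⟩
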